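/- Let $\kappa\in\{2,3,4,\ldots\}\cup\{\infty\}$. For $R=(r_1,\ldots,r_m)\in\mathbb Z_{\ge 0}^m$ and $C=(c_1,\ldots,c_n)\in\mathbb Z_{\ge 0}^n$ with $\sum_i r_i=\sum_j c_j=N$, let $T_\kappa(R,C)$ be the number of $m\times n$ nonnegative integer matrices with row sums $R$, column sums $C$ and all entries at most $\kappa$ (no bound on the entries if $\kappa=\infty$). Let $\binom{n}{r}_\kappa$ denote the coefficient of $x^r$ in $(1+x+x^2+\cdots+x^\kappa)^n$ (in $(1+x+x^2+\cdots)^n$ if $\kappa=\infty$), and let $$I_\kappa(R,C):=\binom{mn}{N}_\kappa^{-1}\prod_{i=1}^m\binom{n}{r_i}_\kappa\prod_{j=1}^n\binom{m}{c_j}_\kappa$$ be the estimate of $T_\kappa(R,C)$ given by the heuristic that the row and the column conditions are independent. For $s\ge 1$ let $R^{(s)}\in\mathbb Z_{\ge 0}^{sm}$ be the concatenation of $s$ copies of $(sr_1,\ldots,sr_m)$, and define $C^{(s)}\in\mathbb Z_{\ge 0}^{sn}$ likewise. Then there is a constant $\delta=\delta(\kappa)\in(0,1)$, depending only on $\kappa$,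 with the following property. For all $m$, $n$, $N$, $R$, $C$ as above with $T_\kappa(R,C)>0$ and $$\Big(\max_{1\le i\le m} r_i\Big)\Big(\max_{1\le j\le n} c_j\Big)<\delta\kappa N$$ (for $\kappa=\infty$ this inequality means only that $N>0$), both of the following limits exist and are finite, and $$\lim_{s\to\infty}\frac1{s^2}\ln T_\kappa(R^{(s)},C^{(s)})\;\ge\;\lim_{s\to\infty}\frac1{s^2}\ln I_\kappa(R^{(s)},C^{(s)}).$$ The inequality is strict if neither $R$ nor $C$ is a constant vector (i.e., if neither $r_1=\cdots=r_m$ nor $c_1=\cdots=c_n$ holds). -/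

import Mathlib

open Filter Topology
open scoped ENNReal

noncomputable section

/-- The contingency tables with margins `R` and `C` and with all entries at most `κ`
(no bound on the entries if `κ = ⊤`). -/
def boundedTables (κ : ℕ∞) {m n : ℕ} (R : Fin m → ℕ) (C : Fin n → ℕ) :
    Set (Matrix (Fin m) (Fin n) ℕ) :=
  {A | (∀ i j, (A i j : ℕ∞) ≤ κ) ∧ (∀ i, ∑ j, A i j = R i) ∧ (∀ j, ∑ i, A i j = C j)}

/-- The row sums bound the entries, so there are finitely many tables (also for `κ = ⊤`). -/
theorem boundedTables_finite (κ : ℕ∞) {m n : ℕ} (R : Fin m → ℕ) (C : Fin n → ℕ) :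
    (boundedTables κ R C).Finite := by
  refine (Set.Finite.pi' (t := fun i : Fin m => {v : Fin n → ℕ | ∀ j, v j ∈ Set.Iic (R i)})
    fun i => Set.Finite.pi' fun _ => Set.finite_Iic (R i)).subset ?_
  intro A hA i j
  rw [Set.mem_Iic, ← hA.2.1 i]
  exact Finset.single_le_sum (f := fun j => A i j) (fun _ _ => Nat.zero_le _) (Finset.mem_univ j)

/-- `T_κ(R, C)`: the number of tables with margins `R` and `C` and entries at most `κ`. -/
def tableCount (κ : ℕ∞) {m n : ℕ} (R : Fin m → ℕ) (C : Fin n → ℕ) : ℕ :=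
  (boundedTables κ R C).ncard

/-- The `(κ+1)`-nomial coefficient: the coefficient of `x ^ r` in
`(1 + x + x ^ 2 + ⋯ + x ^ κ) ^ n`, where the inner sum is the full geometric series
if `κ = ⊤`. -/
def knomial (κ : ℕ∞) (n r : ℕ) : ℕ :=
  open scoped Classical in
  PowerSeries.coeff r ((PowerSeries.mk fun t : ℕ => if (t : ℕ∞) ≤ κ then (1 : ℕ) else 0) ^ n)

/-- The independence heuristic `I_κ(R, C)` for the number of tables; `∑ i, R i` is the
common sum of the two margins. -/
def indepEstimate (κ : ℕ∞) {m n : ℕ} (R : Fin m → ℕ) (C : Fin n → ℕ) : ℝ :=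
  (knomial κ (m * n) (∑ i, R i) : ℝ)⁻¹ * (∏ i, (knomial κ n (R i) : ℝ)) *
    ∏ j, (knomial κ m (C j) : ℝ)

/-- The `s`-fold cloning of a vector: `s` consecutive copies of `s • V`. -/
def clone (s : ℕ) {m : ℕ} (V : Fin m → ℕ) : Fin (s * m) → ℕ :=
  fun k => s * V k.modNat

end

/-! Let H(x) be the largest entropy of a law on {0, …, κ} with mean x. By Cramér's theorem
(`tendsto_log_knomial`), `knomial κ (s * n) (s * r)` has logarithm asymptotic to s n H(r/n) in the
range used here, so the estimate has growth rate Σ n H(r_i/n) + Σ m H(c_j/m) − mn H(N/(mn)).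

The tables have growth rate at least Σ H(r_i c_j/N) (`sum_rate_le_of_tendsto`). Block (i, j) of a
cloned table is filled by tables with constant margins and average entry r_i c_j/N. Prescribing
constant margins costs only a subexponential factor: pigeonhole selects popular margins, and
rotating them over an array of blocks makes them constant (`knomial_le_uniform`). A Fekete argument
in two dimensions gives the limit.

To compare the two rates, write H(x) = h(x) − x log x. The x log x parts agree exactly, because the
table r_i c_j/N is a product with margins R and C (`sum_mul_log_independence`). With u_i = m r_i/N,
of average 1, and y_j = c_j/m, the remaining difference is the Jensen gap over j of g(y) = Σ_i h(u_i
y) − m h(y). Now y² g''(y) = Σ_i φ(u_i y) − m φ(y) with φ(x) = x² h''(x), so a second use of Jensen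
makes g convex as soon as φ is convex, and strictly so if the u_i differ. For κ = ∞, φ(x) = x²/(1+x)
is strictly convex on the whole half-line. For finite κ ≥ 2, h''(0) = 1, so φ is strictly convex
near 0, and the smallness hypothesis keeps all means in that range. -/

/-! ### Coefficients of powers of the truncated geometric series -/

theorem knomial_zero (κ : ℕ∞) (r : ℕ) : knomial κ 0 r = if r = 0 then 1 else 0 := by
  simp [knomial, PowerSeries.coeff_one]

theorem knomial_one (κ : ℕ∞) (r : ℕ) [Decidable ((r : ℕ∞) ≤ κ)] :
    knomial κ 1 r = if (r : ℕ∞) ≤ κ then 1 else 0 := by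
  simp [knomial]

theorem knomial_add (κ : ℕ∞) (a b r : ℕ) :
    knomial κ (a + b) r =
      ∑ p ∈ Finset.HasAntidiagonal.antidiagonal r, knomial κ a p.1 * knomial κ b p.2 := by
  simp [knomial, pow_add, PowerSeries.coeff_mul]

theorem knomial_mul_le (κ : ℕ∞) (a b r r' : ℕ) :
    knomial κ a r * knomial κ b r' ≤ knomial κ (a + b) (r + r') := by
  rw [knomial_add]
  exact Finset.single_le_sum (f := fun p : ℕ × ℕ => knomial κ a p.1 * knomial κ b p.2)
    (fun _ _ => Nat.zero_le _) (a := (r, r')) (by simp)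

/-- A finite `K ≤ κ` stands in for `κ`, so that `κ = ⊤` needs no separate case. The last entry
greedily takes `min r K`. -/
theorem knomial_pos {κ : ℕ∞} {K : ℕ} (hK : (K : ℕ∞) ≤ κ) (n : ℕ) :
    ∀ r, r ≤ K * n → 0 < knomial κ n r := by
  classical
  induction n with
  | zero => intro r hr; simp_all [knomial_zero]
  | succ n ih =>
    intro r hr
    have h1 := knomial_mul_le κ n 1 (r - min r K) (min r K)
    rw [Nat.sub_add_cancel (min_le_left _ _)] at h1
    refine lt_of_lt_of_le (Nat.mul_pos (ih _ ?_) ?_) h1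
    · rw [mul_add, mul_one] at hr
      rcases le_total r K with h | h
      · simp [h]
      · rw [min_eq_right h]; omega
    · have : ((min r K : ℕ) : ℕ∞) ≤ κ := le_trans (by exact_mod_cast min_le_right r K) hK
      rw [knomial_one, if_pos this]; exact one_pos

/-- The vectors with entries at most `κ` and with sum `r`. -/
def boundedVectors (κ : ℕ∞) (ι : Type*) [Fintype ι] (r : ℕ) : Set (ι → ℕ) :=
  {v | (∀ i, (v i : ℕ∞) ≤ κ) ∧ ∑ i, v i = r}

theorem ncard_boundedVectors (κ : ℕ∞) (ι : Type*) [Fintype ι] (r : ℕ) :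
    (boundedVectors κ ι r).ncard = knomial κ (Fintype.card ι) r := by
  classical
  have h1 : knomial κ (Fintype.card ι) r =
      ((Finset.finsuppAntidiag Finset.univ r).filter
        fun l : ι →₀ ℕ => ∀ i, (l i : ℕ∞) ≤ κ).card := by
    rw [knomial, ← Finset.card_univ, ← Finset.prod_const, PowerSeries.coeff_prod,
      Finset.card_filter]
    refine Finset.sum_congr rfl fun l _ => ?_
    simp only [PowerSeries.coeff_mk]
    rw [Finset.prod_ite_zero]
    simp
  rw [h1, ← Set.ncard_coe_finset]
  refine (Set.ncard_congr (fun (l : ι →₀ ℕ) _ => (l : ι → ℕ)) ?_ ?_ ?_).symm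
  · intro l hl
    simp [boundedVectors] at hl ⊢
    exact ⟨hl.2, hl.1⟩
  · intro a b _ _ hab
    exact DFunLike.coe_injective hab
  · intro v hv
    refine ⟨Finsupp.equivFunOnFinite.symm v, ?_, rfl⟩
    simp [boundedVectors] at hv ⊢
    exact ⟨hv.2, hv.1⟩

theorem hasSum_knomial {κ : ℕ∞} {z f : ℝ}
    (hf : HasSum (fun t => (knomial κ 1 t : ℝ) * z ^ t) f) (n : ℕ) :
    HasSum (fun r => (knomial κ n r : ℝ) * z ^ r) (f ^ n) := by
  induction n with
  | zero =>
    rw [pow_zero]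
    convert hasSum_ite_eq (0 : ℕ) (1 : ℝ) using 2 with r
    by_cases h : r = 0 <;> simp [knomial_zero, h]
  | succ n ih =>
    have hn : ∀ k, Summable (fun r => (knomial κ k r : ℝ) * z ^ r) →
        Summable fun r => ‖(knomial κ k r : ℝ) * z ^ r‖ := fun k hk => hk.norm
    have h1 := summable_norm_sum_mul_antidiagonal_of_summable_norm
      (hn _ ih.summable) (hn _ hf.summable)
    have h2 := tsum_mul_tsum_eq_tsum_sum_antidiagonal_of_summable_norm
      (hn _ ih.summable) (hn _ hf.summable)
    rw [ih.tsum_eq, hf.tsum_eq] at h2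
    have h3 : (fun r => (knomial κ (n + 1) r : ℝ) * z ^ r) = fun r =>
        ∑ p ∈ Finset.HasAntidiagonal.antidiagonal r,
          (knomial κ n p.1 : ℝ) * z ^ p.1 * ((knomial κ 1 p.2 : ℝ) * z ^ p.2) := by
      funext r
      rw [knomial_add]
      push_cast
      rw [Finset.sum_mul]
      refine Finset.sum_congr rfl fun p hp => ?_
      rw [← Finset.HasAntidiagonal.mem_antidiagonal.1 hp, pow_add]
      ring
    rw [pow_succ, h2, h3]
    exact h1.of_norm.hasSum

/-- Chernoff bound: one nonnegative term is at most the whole series. -/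
theorem knomial_mul_pow_le {κ : ℕ∞} {z f : ℝ} (hz : 0 ≤ z)
    (hf : HasSum (fun t => (knomial κ 1 t : ℝ) * z ^ t) f) (n r : ℕ) :
    (knomial κ n r : ℝ) * z ^ r ≤ f ^ n :=
  le_hasSum (hasSum_knomial hf n) r fun _ _ => by positivity

theorem knomial_one_top (t : ℕ) : knomial ⊤ 1 t = 1 := by
  classical
  simp [knomial_one]

theorem hasSum_knomial_one_top {z : ℝ} (h0 : 0 ≤ z) (h1 : z < 1) :
    HasSum (fun t => (knomial ⊤ 1 t : ℝ) * z ^ t) (1 - z)⁻¹ := by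
  simpa [knomial_one_top] using hasSum_geometric_of_lt_one h0 h1

theorem hasSum_knomial_one_nat (K : ℕ) (z : ℝ) :
    HasSum (fun t => (knomial K 1 t : ℝ) * z ^ t) (∑ t ∈ Finset.range (K + 1), z ^ t) := by
  classical
  have : ∑ t ∈ Finset.range (K + 1), z ^ t =
      ∑ t ∈ Finset.range (K + 1), (knomial K 1 t : ℝ) * z ^ t := by
    refine Finset.sum_congr rfl fun t ht => ?_
    rw [knomial_one, if_pos (by simpa using Nat.lt_succ_iff.1 (Finset.mem_range.1 ht))]
    simp
  rw [this]
  refine hasSum_sum_of_ne_finset_zero fun t ht => ?_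
  rw [knomial_one, if_neg (by simpa using ht)]
  simp

theorem knomial_mono {κ κ' : ℕ∞} (h : κ ≤ κ') (n r : ℕ) : knomial κ n r ≤ knomial κ' n r := by
  classical
  induction n generalizing r with
  | zero => simp [knomial_zero]
  | succ n ih =>
    rw [knomial_add, knomial_add]
    refine Finset.sum_le_sum fun p _ => Nat.mul_le_mul (ih _) ?_
    rw [knomial_one, knomial_one]
    split_ifs with h1 h2 <;> simp
    exact h2 (h1.trans h)

theorem knomial_le_two_pow (κ : ℕ∞) (n r : ℕ) : (knomial κ n r : ℝ) ≤ 2 ^ (n + r) := by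
  have h := knomial_mul_pow_le (z := 1 / 2) (by norm_num)
    (hasSum_knomial_one_top (z := 1 / 2) (by norm_num) (by norm_num)) n r
  have h3 : (knomial κ n r : ℝ) ≤ knomial ⊤ n r := by exact_mod_cast knomial_mono le_top n r
  refine h3.trans ?_
  rw [one_div, inv_pow, ← div_eq_mul_inv, div_le_iff₀ (by positivity)] at h
  norm_num at h
  rwa [pow_add]

/-! ### Counting tables: gluing, pigeonhole and equalization of margins -/

section Tables

variable {I J I' J' A B : Type*} [Fintype I] [Fintype J] [Fintype I'] [Fintype J'] [Fintype A]
  [Fintype B]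

/-- Contingency tables with rows and columns indexed by arbitrary finite types. -/
def marginTables (κ : ℕ∞) (R : I → ℕ) (C : J → ℕ) : Set (I → J → ℕ) :=
  {A | (∀ i j, (A i j : ℕ∞) ≤ κ) ∧ (∀ i, ∑ j, A i j = R i) ∧ ∀ j, ∑ i, A i j = C j}

theorem finite_marginTables (κ : ℕ∞) (R : I → ℕ) (C : J → ℕ) : (marginTables κ R C).Finite := by
  refine (Set.Finite.pi' (t := fun i : I => {v : J → ℕ | ∀ j, v j ∈ Set.Iic (R i)})
    fun i => Set.Finite.pi' fun _ => Set.finite_Iic (R i)).subset ?_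
  intro A hA i j
  rw [Set.mem_Iic, ← hA.2.1 i]
  exact Finset.single_le_sum (f := fun j => A i j) (fun _ _ => Nat.zero_le _) (Finset.mem_univ j)

/-- The number of contingency tables with margins `R` and `C` and entries at most `κ`. -/
noncomputable def marginCount (κ : ℕ∞) (R : I → ℕ) (C : J → ℕ) : ℕ :=
  (marginTables κ R C).ncard

theorem tableCount_eq_marginCount (κ : ℕ∞) {m n : ℕ} (R : Fin m → ℕ) (C : Fin n → ℕ) :
    tableCount κ R C = marginCount κ R C := rfl

theorem marginCount_pos_iff {κ : ℕ∞} {R : I → ℕ} {C : J → ℕ} :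
    0 < marginCount κ R C ↔ (marginTables κ R C).Nonempty :=
  Set.ncard_pos (finite_marginTables κ R C)

theorem marginCount_le_comp_equiv (κ : ℕ∞) (R : I → ℕ) (C : J → ℕ) (e : I' ≃ I) (f : J' ≃ J) :
    marginCount κ R C ≤ marginCount κ (R ∘ e) (C ∘ f) := by
  refine Set.ncard_le_ncard_of_injOn (fun A i j => A (e i) (f j)) ?_ ?_ (finite_marginTables _ _ _)
  · intro A hA
    refine ⟨fun i j => hA.1 _ _, fun i => ?_, fun j => ?_⟩
    · rw [Function.comp, ← hA.2.1]
      exact f.sum_comp (fun j => A (e i) j)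
    · rw [Function.comp, ← hA.2.2]
      exact e.sum_comp (fun i => A i (f j))
  · intro A _ A' _ h
    funext i j
    simpa using congrFun (congrFun h (e.symm i)) (f.symm j)

theorem marginCount_comp_equiv (κ : ℕ∞) (R : I → ℕ) (C : J → ℕ) (e : I' ≃ I) (f : J' ≃ J) :
    marginCount κ (R ∘ e) (C ∘ f) = marginCount κ R C := by
  refine le_antisymm ?_ (marginCount_le_comp_equiv κ R C e f)
  have h := marginCount_le_comp_equiv κ (R ∘ e) (C ∘ f) e.symm f.symm
  simpa [Function.comp_def] using h

theorem marginCount_swap_le (κ : ℕ∞) (R : I → ℕ) (C : J → ℕ) :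
    marginCount κ R C ≤ marginCount κ C R := by
  refine Set.ncard_le_ncard_of_injOn (fun A j i => A i j) ?_ ?_ (finite_marginTables _ _ _)
  · intro A hA
    exact ⟨fun i j => hA.1 _ _, hA.2.2, hA.2.1⟩
  · intro A _ A' _ h
    funext i j
    exact congrFun (congrFun h j) i

theorem marginCount_swap (κ : ℕ∞) (R : I → ℕ) (C : J → ℕ) :
    marginCount κ R C = marginCount κ C R :=
  le_antisymm (marginCount_swap_le κ R C) (marginCount_swap_le κ C R)

theorem marginCount_mul_le_sumElim (κ : ℕ∞) (R : I → ℕ) (R' : I' → ℕ) (C C' : J → ℕ) :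
    marginCount κ R C * marginCount κ R' C' ≤ marginCount κ (Sum.elim R R') (C + C') := by
  rw [marginCount, marginCount, ← Set.ncard_prod]
  refine Set.ncard_le_ncard_of_injOn (fun p => Sum.elim p.1 p.2) ?_ ?_ (finite_marginTables _ _ _)
  · rintro ⟨A, A'⟩ ⟨hA, hA'⟩
    refine ⟨?_, ?_, fun j => ?_⟩
    · rintro (i | i) j
      exacts [hA.1 i j, hA'.1 i j]
    · rintro (i | i)
      exacts [hA.2.1 i, hA'.2.1 i]
    · simp only [Fintype.sum_sum_type, Sum.elim_inl, Sum.elim_inr, Pi.add_apply]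
      rw [hA.2.2, hA'.2.2]
  · rintro ⟨A, A'⟩ _ ⟨D, D'⟩ _ h
    refine Prod.ext ?_ ?_
    · funext i; exact congrFun h (Sum.inl i)
    · funext i; exact congrFun h (Sum.inr i)

/-- Assembling a table from blocks. -/
theorem prod_marginCount_le (κ : ℕ∞) (R : A → B → I → ℕ) (C : A → B → J → ℕ) :
    ∏ a, ∏ b, marginCount κ (R a b) (C a b) ≤
      marginCount κ (fun p : A × I => ∑ b, R p.1 b p.2) (fun q : B × J => ∑ a, C a q.1 q.2) := by
  classical
  have h1 : ∏ a, ∏ b, marginCount κ (R a b) (C a b) =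
      (Set.univ.pi fun p : A × B => marginTables κ (R p.1 p.2) (C p.1 p.2)).ncard := by
    rw [← Nat.card_coe_set_eq, Nat.card_congr (Equiv.Set.univPi _), Nat.card_pi,
      Fintype.prod_prod_type]
    rfl
  rw [h1]
  refine Set.ncard_le_ncard_of_injOn
    (fun M (p : A × I) (q : B × J) => M (p.1, q.1) p.2 q.2) ?_ ?_ (finite_marginTables _ _ _)
  · intro M hM
    have hM' : ∀ a b, M (a, b) ∈ marginTables κ (R a b) (C a b) := fun a b => hM (a, b) trivial
    refine ⟨fun p q => (hM' _ _).1 _ _, fun p => ?_, fun q => ?_⟩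
    · rw [Fintype.sum_prod_type]
      exact Finset.sum_congr rfl fun b _ => (hM' p.1 b).2.1 p.2
    · rw [Fintype.sum_prod_type]
      exact Finset.sum_congr rfl fun a _ => (hM' a q.1).2.2 q.2
  · intro M _ M' _ h
    funext ⟨a, b⟩ i j
    exact congrFun (congrFun h (a, i)) (b, j)

/-- Forgetting the margins and keeping only the total. -/
theorem marginCount_le_knomial (κ : ℕ∞) (R : I → ℕ) (C : J → ℕ) :
    marginCount κ R C ≤ knomial κ (Fintype.card I * Fintype.card J) (∑ i, R i) := by
  rw [← Fintype.card_prod, ← ncard_boundedVectors]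
  refine Set.ncard_le_ncard_of_injOn (fun A p => A p.1 p.2) ?_ ?_ ?_
  · intro A hA
    refine ⟨fun p => hA.1 _ _, ?_⟩
    rw [Fintype.sum_prod_type]
    exact Finset.sum_congr rfl fun i _ => hA.2.1 i
  · intro A _ A' _ h
    funext i j
    exact congrFun h (i, j)
  · refine (Set.Finite.pi' (t := fun _ : I × J => Set.Iic (∑ i, R i))
      fun _ => Set.finite_Iic _).subset ?_
    intro v hv i
    rw [Set.mem_Iic, ← hv.2]
    exact Finset.single_le_sum (f := v) (fun _ _ => Nat.zero_le _) (Finset.mem_univ i)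

/-- Some choice of margins is at least as frequent as the average. -/
theorem exists_knomial_le_marginCount (κ : ℕ∞) (I J : Type) [Fintype I] [Fintype J] (r : ℕ) :
    ∃ (R : I → ℕ) (C : J → ℕ), (knomial κ (Fintype.card I * Fintype.card J) r ≤
        (r + 1) ^ (Fintype.card I + Fintype.card J) * marginCount κ R C) ∧
      (0 < knomial κ (Fintype.card I * Fintype.card J) r → ∑ i, R i = r ∧ ∑ j, C j = r) := by
  classical
  set k := knomial κ (Fintype.card I * Fintype.card J) r with hk
  rcases Nat.eq_zero_or_pos k with h0 | hpos
  -- With nothing to count, any margins serve; the claim about their sums is vacuous.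
  · exact ⟨0, 0, by omega, by omega⟩
  have hk' : k = (boundedVectors κ (I × J) r).ncard := by
    rw [ncard_boundedVectors, Fintype.card_prod]
  have hfin : (boundedVectors κ (I × J) r).Finite :=
    Set.finite_of_ncard_pos (by omega)
  set S := hfin.toFinset with hS
  have hcard : S.card = k := by rw [hk', Set.ncard_eq_toFinset_card _ hfin]
  have hle : ∀ v ∈ S, (∀ i, ∑ j, v (i, j) < r + 1) ∧ ∀ j, ∑ i, v (i, j) < r + 1 := by
    intro v hv
    rw [hS, Set.Finite.mem_toFinset] at hv
    have h1 : ∑ i, ∑ j, v (i, j) = r := by rw [← hv.2, Fintype.sum_prod_type]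
    have h2 : ∑ j, ∑ i, v (i, j) = r := by rw [Finset.sum_comm, h1]
    refine ⟨fun i => ?_, fun j => ?_⟩
    · rw [Nat.lt_succ_iff, ← h1]
      exact Finset.single_le_sum (f := fun i => ∑ j, v (i, j)) (fun _ _ => Nat.zero_le _)
        (Finset.mem_univ i)
    · rw [Nat.lt_succ_iff, ← h2]
      exact Finset.single_le_sum (f := fun j => ∑ i, v (i, j)) (fun _ _ => Nat.zero_le _)
        (Finset.mem_univ j)
  -- Reduction modulo `r + 1` loses nothing on `S`, where every margin is at most `r`; it makes the
  -- codomain finite, of size `(r + 1) ^ (|I| + |J|)`.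
  let g : (I × J → ℕ) → (I → Fin (r + 1)) × (J → Fin (r + 1)) := fun v =>
    (fun i => Fin.ofNat (r + 1) (∑ j, v (i, j)), fun j => Fin.ofNat (r + 1) (∑ i, v (i, j)))
  obtain ⟨⟨R, C⟩, -, hRC⟩ := Finset.exists_le_card_fiber_of_nsmul_le_card_of_maps_to
    (s := S) (t := Finset.univ) (f := g) (b := (k : ℚ) / (r + 1) ^ (Fintype.card I + Fintype.card J))
    (fun _ _ => Finset.mem_univ _) Finset.univ_nonempty (by
      rw [hcard, Finset.card_univ]
      simp only [Fintype.card_prod, Fintype.card_fun, Fintype.card_fin, nsmul_eq_mul]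
      push_cast
      rw [← pow_add, mul_div_cancel₀]
      positivity)
  have hsub : (({v ∈ S | g v = (R, C)} : Finset _)).card ≤
      marginCount κ (fun i => (R i : ℕ)) (fun j => (C j : ℕ)) := by
    rw [← Set.ncard_coe_finset]
    refine Set.ncard_le_ncard_of_injOn (fun v i j => v (i, j)) ?_ ?_ (finite_marginTables _ _ _)
    · intro v hv
      simp only [Finset.coe_filter, Set.mem_ofPred_eq, g, Prod.mk.injEq] at hv
      have hv2 := hle v hv.1
      have hv3 := hv.1
      rw [hS, Set.Finite.mem_toFinset] at hv3
      refine ⟨fun i j => hv3.1 _, fun i => ?_, fun j => ?_⟩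
      · rw [← hv.2.1]
        simp [Nat.mod_eq_of_lt (hv2.1 i)]
      · rw [← hv.2.2]
        simp [Nat.mod_eq_of_lt (hv2.2 j)]
    · intro v _ v' _ h
      funext ⟨i, j⟩
      exact congrFun (congrFun h i) j
  have hpos' : 0 < ({v ∈ S | g v = (R, C)} : Finset _).card := by
    have : (0 : ℚ) < (({v ∈ S | g v = (R, C)} : Finset _).card : ℚ) :=
      lt_of_lt_of_le (by positivity) hRC
    exact_mod_cast this
  refine ⟨fun i => R i, fun j => C j, ?_, fun _ => ?_⟩
  · rw [div_le_iff₀ (by positivity)] at hRC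
    have : k ≤ ({v ∈ S | g v = (R, C)} : Finset _).card *
      (r + 1) ^ (Fintype.card I + Fintype.card J) := by exact_mod_cast hRC
    refine this.trans ?_
    rw [mul_comm]
    exact Nat.mul_le_mul_left _ hsub
  · obtain ⟨v, hv⟩ := Finset.card_pos.1 hpos'
    simp only [Finset.mem_filter, g, Prod.mk.injEq] at hv
    have hv2 := hle v hv.1
    have hv3 := hv.1
    rw [hS, Set.Finite.mem_toFinset] at hv3
    have h1 : ∑ i, ∑ j, v (i, j) = r := by rw [← hv3.2, Fintype.sum_prod_type]
    rw [← hv.2.1, ← hv.2.2]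
    refine ⟨?_, ?_⟩
    · simp only [Fin.val_ofNat]
      rw [← h1]
      refine Finset.sum_congr rfl fun i _ => ?_
      rw [h1]
      exact Nat.mod_eq_of_lt (hv2.1 i)
    · simp only [Fin.val_ofNat]
      rw [← h1, Finset.sum_comm]
      refine Finset.sum_congr rfl fun j _ => ?_
      rw [Finset.sum_comm, h1]
      exact Nat.mod_eq_of_lt (hv2.2 j)

/-- Rotating the margins over a `q × q` array of blocks equalizes them. -/
theorem marginCount_pow_le_uniform (κ : ℕ∞) {q : ℕ} [NeZero q] (R C : Fin q → ℕ) {r : ℕ}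
    (hR : ∑ i, R i = r) (hC : ∑ j, C j = r) :
    marginCount κ R C ^ (q * q) ≤
      marginCount κ (fun _ : Fin q × Fin q => r) (fun _ : Fin q × Fin q => r) := by
  -- Block `(a, b)` carries the margins shifted cyclically by `a + b`. Along any row or column of
  -- the array every shift occurs once, so all margins of the assembled table equal `r`.
  have h := prod_marginCount_le κ (fun a b i : Fin q => R (i + a + b))
    (fun a b j : Fin q => C (j + b + a))
  have h1 : ∀ a b : Fin q, marginCount κ (fun i : Fin q => R (i + a + b))
      (fun j : Fin q => C (j + b + a)) = marginCount κ R C := fun a b => by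
    rw [← marginCount_comp_equiv κ R C (Equiv.addRight (a + b)) (Equiv.addRight (b + a))]
    simp [Function.comp_def, add_assoc]
  simp only [h1, Finset.prod_const, Finset.card_univ, Fintype.card_fin, ← pow_mul] at h
  have h2 : ∀ (V : Fin q → ℕ) (p : Fin q × Fin q), ∑ b, V (p.2 + p.1 + b) = ∑ i, V i :=
    fun V p => Equiv.sum_comp (Equiv.addLeft (p.2 + p.1)) V
  simpa only [h2, hR, hC] using h

/-- Popular margins lose only a factor `(r + 1) ^ (2 * q)`; rotation raises the inequality to the
power `q * q`. After taking logarithms and dividing by `q ^ 4`, the loss is of order `log (r + 1) /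
q`. -/
theorem knomial_le_uniform (κ : ℕ∞) {q : ℕ} [NeZero q] (r : ℕ) (hr : 0 < knomial κ (q * q) r) :
    knomial κ (q * q) r ^ (q * q) ≤ (r + 1) ^ (2 * q * (q * q)) *
      marginCount κ (fun _ : Fin q × Fin q => r) (fun _ : Fin q × Fin q => r) := by
  obtain ⟨R, C, h1, h2⟩ := exists_knomial_le_marginCount κ (Fin q) (Fin q) r
  rw [Fintype.card_fin] at h1 h2
  obtain ⟨hR, hC⟩ := h2 hr
  calc _ ≤ ((r + 1) ^ (q + q) * marginCount κ R C) ^ (q * q) := Nat.pow_le_pow_left h1 _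
    _ = (r + 1) ^ (2 * q * (q * q)) * marginCount κ R C ^ (q * q) := by
      rw [mul_pow, ← pow_mul, two_mul]
    _ ≤ _ := Nat.mul_le_mul_left _ (marginCount_pow_le_uniform κ R C hR hC)

end Tables

/-! ### Growth rate of the table counts under cloning -/

/-- A two-dimensional Fekete lemma. -/
theorem exists_tendsto_div_sq {u : ℕ → ℝ} {B : ℝ} (h0 : ∀ s, 0 ≤ u s)
    (hB : ∀ s, u s ≤ B * (s : ℝ) ^ 2) (hu : ∀ k q t : ℕ, (q : ℝ) ^ 2 * u k ≤ u (q * k + t)) :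
    ∃ L, Tendsto (fun s : ℕ => 1 / (s : ℝ) ^ 2 * u s) atTop (𝓝 L) ∧
      ∀ k : ℕ, 1 / (k : ℝ) ^ 2 * u k ≤ L := by
  have hB0 : 0 ≤ B := by simpa using (h0 1).trans (hB 1)
  have hle : ∀ s : ℕ, 1 / (s : ℝ) ^ 2 * u s ≤ B := fun s => by
    rcases Nat.eq_zero_or_pos s with rfl | hs
    · simpa using hB0
    · have hs' : (0 : ℝ) < s := by exact_mod_cast hs
      rw [one_div, inv_mul_le_iff₀ (by positivity), mul_comm]
      exact hB s
  have hbdd : BddAbove (Set.range fun s : ℕ => 1 / (s : ℝ) ^ 2 * u s) := by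
    refine ⟨B, ?_⟩
    rintro _ ⟨s, rfl⟩
    exact hle s
  refine ⟨⨆ s : ℕ, 1 / (s : ℝ) ^ 2 * u s, ?_, fun k => le_ciSup hbdd k⟩
  refine tendsto_order.2 ⟨fun a ha => ?_, fun a ha => Eventually.of_forall fun s =>
    (le_ciSup hbdd s).trans_lt ha⟩
  obtain ⟨k, hk⟩ := exists_lt_of_lt_ciSup ha
  -- For `k = 0` division by zero gives the value 0, which is below every term of the sequence.
  rcases Nat.eq_zero_or_pos k with rfl | hkpos
  · refine Eventually.of_forall fun s => lt_of_lt_of_le hk ?_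
    have := h0 s
    simp only [CharP.cast_eq_zero, ne_eq, OfNat.ofNat_ne_zero, not_false_eq_true, zero_pow,
      div_zero, zero_mul]
    positivity
  have hk' : (0 : ℝ) < k := by exact_mod_cast hkpos
  -- The comparison `⌊s / k⌋ ≥ s / k - 1` turns the hypothesis into this lower bound for `u s / s ^
  -- 2`.
  have hlim : Tendsto (fun s : ℕ => (1 / (k : ℝ) - 1 / (s : ℝ)) ^ 2 * u k) atTop
      (𝓝 ((1 / (k : ℝ) - 0) ^ 2 * u k)) :=
    ((tendsto_const_nhds.sub tendsto_one_div_atTop_nhds_zero_nat).pow 2).mul_const _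
  have h1 : a < (1 / (k : ℝ) - 0) ^ 2 * u k := by simpa using hk
  filter_upwards [hlim.eventually_const_lt h1, eventually_ge_atTop k] with s hs hsk
  refine hs.trans_le ?_
  have hs' : (0 : ℝ) < s := hk'.trans_le (by exact_mod_cast hsk)
  have h2 := hu k (s / k) (s % k)
  rw [Nat.div_add_mod'] at h2
  rw [one_div ((s : ℝ) ^ 2), le_inv_mul_iff₀ (by positivity)]
  refine le_trans ?_ h2
  rw [← mul_assoc, ← mul_pow]
  refine mul_le_mul_of_nonneg_right ?_ (h0 k)
  have h3 : (s : ℝ) * (1 / k - 1 / s) = s / k - 1 := by field_simp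
  rw [h3]
  have h4 : (1 : ℝ) ≤ s / k := by rw [le_div_iff₀ hk']; simpa using hsk
  have h5 : (s : ℝ) / k - 1 ≤ ((s / k : ℕ) : ℝ) := by
    have : (s : ℝ) < k * ((s / k : ℕ) + 1 : ℝ) := by
      exact_mod_cast Nat.lt_mul_div_succ s hkpos
    rw [sub_le_iff_le_add, div_le_iff₀ hk']
    linarith
  exact pow_le_pow_left₀ (by linarith) h5 2

section Tiling

variable {m n : ℕ}

/-- The number of `a m × b n` tables whose margins are those of an `a × b` array of
`m × n` tables with margins `R` and `C`. -/
noncomputable def tiledCount (κ : ℕ∞) (R : Fin m → ℕ) (C : Fin n → ℕ) (a b : ℕ) : ℕ :=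
  marginCount κ (fun p : Fin a × Fin m => b * R p.2) (fun p : Fin b × Fin n => a * C p.2)

theorem tableCount_clone (κ : ℕ∞) (R : Fin m → ℕ) (C : Fin n → ℕ) (s : ℕ) :
    tableCount κ (clone s R) (clone s C) = tiledCount κ R C s s := by
  rw [tableCount_eq_marginCount, ← marginCount_comp_equiv κ _ _ finProdFinEquiv finProdFinEquiv,
    tiledCount]
  have h : ∀ (l : ℕ) (V : Fin l → ℕ), clone s V ∘ finProdFinEquiv = fun p => s * V p.2 := by
    intro l V
    funext p
    have : (finProdFinEquiv.symm (finProdFinEquiv p)).2 = p.2 := by simp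
    simp only [clone, Function.comp]
    rw [← this]
    rfl
  rw [h, h]

theorem tiledCount_swap (κ : ℕ∞) (R : Fin m → ℕ) (C : Fin n → ℕ) (a b : ℕ) :
    tiledCount κ R C a b = tiledCount κ C R b a :=
  marginCount_swap _ _ _

theorem tiledCount_pos {κ : ℕ∞} {R : Fin m → ℕ} {C : Fin n → ℕ} (h : 0 < tableCount κ R C)
    (a b : ℕ) : 0 < tiledCount κ R C a b := by
  rw [tableCount_eq_marginCount, marginCount_pos_iff] at h
  obtain ⟨A, hA⟩ := h
  refine marginCount_pos_iff.2 ⟨fun p q => A p.2 q.2, fun p q => hA.1 _ _, fun p => ?_, fun q => ?_⟩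
  · rw [Fintype.sum_prod_type]
    simp [hA.2.1]
  · rw [Fintype.sum_prod_type]
    simp [hA.2.2]

theorem tiledCount_add_left (κ : ℕ∞) (R : Fin m → ℕ) (C : Fin n → ℕ) (a a' b : ℕ) :
    tiledCount κ R C a b * tiledCount κ R C a' b ≤ tiledCount κ R C (a + a') b := by
  refine (marginCount_mul_le_sumElim _ _ _ _ _).trans (le_of_eq ?_)
  rw [tiledCount, ← marginCount_comp_equiv κ _ _ ((Equiv.sumProdDistrib _ _ _).symm.trans
    (finSumFinEquiv.prodCongr (Equiv.refl (Fin m)))) (Equiv.refl _)]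
  congr 1
  · funext p
    rcases p with p | p <;> rfl
  · funext p
    simp [add_mul]

/-- Extra tiles can always be filled, since one table exists. Rows are added first, then columns by
transposition, which is why the two numbers of copies are kept independent. -/
theorem tiledCount_le_add {κ : ℕ∞} {R : Fin m → ℕ} {C : Fin n → ℕ} (h : 0 < tableCount κ R C)
    (a a' b b' : ℕ) : tiledCount κ R C a b ≤ tiledCount κ R C (a + a') (b + b') := by
  have h1 : ∀ {m n : ℕ} {R : Fin m → ℕ} {C : Fin n → ℕ}, 0 < tableCount κ R C → ∀ a a' b,
      tiledCount κ R C a b ≤ tiledCount κ R C (a + a') b := fun h a a' b =>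
    (Nat.le_mul_of_pos_right _ (tiledCount_pos h _ _)).trans (tiledCount_add_left κ _ _ a a' b)
  have h' : 0 < tableCount κ C R := by
    rwa [tableCount_eq_marginCount, marginCount_swap, ← tableCount_eq_marginCount]
  refine (h1 h a a' b).trans ?_
  rw [tiledCount_swap κ R C, tiledCount_swap κ R C]
  exact h1 h' b b' (a + a')

theorem tiledCount_pow_le (κ : ℕ∞) (R : Fin m → ℕ) (C : Fin n → ℕ) (k q : ℕ) :
    tiledCount κ R C k k ^ (q * q) ≤ tiledCount κ R C (q * k) (q * k) := by
  have h := prod_marginCount_le κ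
    (fun (_ _ : Fin q) (p : Fin k × Fin m) => k * R p.2)
    (fun (_ _ : Fin q) (p : Fin k × Fin n) => k * C p.2)
  rw [tiledCount, tiledCount, ← marginCount_comp_equiv κ (fun p : Fin (q * k) × Fin m => _) _
    ((Equiv.prodAssoc _ _ _).symm.trans (finProdFinEquiv.prodCongr (Equiv.refl (Fin m))))
    ((Equiv.prodAssoc _ _ _).symm.trans (finProdFinEquiv.prodCongr (Equiv.refl (Fin n))))]
  simp only [Finset.prod_const, Finset.card_univ, Fintype.card_fin, ← pow_mul, Finset.sum_const,
    smul_eq_mul] at h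
  refine h.trans (le_of_eq ?_)
  congr 1 <;> funext p <;> simp [mul_assoc]

/-- The limit dominates every normalized term, so any single tiling gives a lower bound for it;
finiteness comes from discarding the margins and the crude bound `knomial_le_two_pow`. -/
theorem exists_tendsto_log_tableCount {κ : ℕ∞} {R : Fin m → ℕ} {C : Fin n → ℕ}
    (h : 0 < tableCount κ R C) :
    ∃ L, Tendsto (fun s : ℕ => 1 / (s : ℝ) ^ 2 *
        Real.log (tableCount κ (clone s R) (clone s C))) atTop (𝓝 L) ∧
      ∀ k : ℕ, 1 / (k : ℝ) ^ 2 * Real.log (tiledCount κ R C k k) ≤ L := by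
  have hpos : ∀ k, (0 : ℝ) < tiledCount κ R C k k := fun k => by
    exact_mod_cast tiledCount_pos h k k
  simp only [tableCount_clone]
  refine exists_tendsto_div_sq (B := (m * n + ∑ i, R i : ℕ) * Real.log 2)
    (fun s => Real.log_natCast_nonneg _) (fun s => ?_) (fun k q t => ?_)
  · have h1 : (tiledCount κ R C s s : ℝ) ≤ 2 ^ (s ^ 2 * (m * n + ∑ i, R i)) := by
      have h2 := marginCount_le_knomial κ (fun p : Fin s × Fin m => s * R p.2)
        (fun p : Fin s × Fin n => s * C p.2)
      have h3 : (tiledCount κ R C s s : ℝ) ≤ _ := Nat.cast_le.2 h2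
      refine (h3.trans (knomial_le_two_pow _ _ _)).trans (le_of_eq ?_)
      congr 1
      simp only [Fintype.card_prod, Fintype.card_fin, Fintype.sum_prod_type, Finset.sum_const,
        Finset.card_univ, smul_eq_mul, ← Finset.mul_sum]
      ring
    have h2 := Real.log_le_log (hpos s) h1
    rw [Real.log_pow] at h2
    push_cast at h2 ⊢
    linarith
  · have h1 : (tiledCount κ R C k k : ℝ) ^ (q * q) ≤ tiledCount κ R C (q * k + t) (q * k + t) := by
      exact_mod_cast (tiledCount_pow_le κ R C k q).trans (tiledCount_le_add h _ _ _ _)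
    have h2 := Real.log_le_log (pow_pos (hpos k) _) h1
    rw [Real.log_pow] at h2
    push_cast at h2
    rwa [pow_two]

/-- Filling the block `(i, j)` by tables with constant margins `q * t i j`. -/
theorem prod_uniform_le_tiledCount (κ : ℕ∞) {R : Fin m → ℕ} {C : Fin n → ℕ} {q : ℕ}
    (t : Fin m → Fin n → ℕ) (hR : ∀ i, ∑ j, t i j = q * R i) (hC : ∀ j, ∑ i, t i j = q * C j) :
    ∏ i, ∏ j, marginCount κ (fun _ : Fin q × Fin q => q * t i j)
      (fun _ : Fin q × Fin q => q * t i j) ≤ tiledCount κ R C (q * q) (q * q) := by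
  refine (prod_marginCount_le κ (fun i j (_ : Fin q × Fin q) => q * t i j)
    (fun i j (_ : Fin q × Fin q) => q * t i j)).trans (le_of_eq ?_)
  rw [tiledCount, ← marginCount_comp_equiv κ (fun p : Fin (q * q) × Fin m => _) _
    ((Equiv.prodComm _ _).trans (finProdFinEquiv.prodCongr (Equiv.refl (Fin m))))
    ((Equiv.prodComm _ _).trans (finProdFinEquiv.prodCongr (Equiv.refl (Fin n))))]
  congr 1 <;> funext p <;> simp [mul_assoc, ← Finset.mul_sum, hR, hC]

/-- `knomial_le_uniform` with `r = q * t i j`, in logarithms and divided by `q ^ 4`; the factor `(r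
+ 1) ^ (2 * q * (q * q))` becomes the error term. -/
theorem sum_log_knomial_le_log_tiledCount {κ : ℕ∞} {R : Fin m → ℕ} {C : Fin n → ℕ} {q : ℕ}
    (hq : 0 < q) (t : Fin m → Fin n → ℕ) (hR : ∀ i, ∑ j, t i j = q * R i)
    (hC : ∀ j, ∑ i, t i j = q * C j) (hk : ∀ i j, 0 < knomial κ (q * q) (q * t i j)) :
    ∑ i, ∑ j, (1 / (q : ℝ) ^ 2 * Real.log (knomial κ (q * q) (q * t i j)) -
        2 * (Real.log (q * t i j + 1) / q)) ≤
      1 / ((q * q : ℕ) : ℝ) ^ 2 * Real.log (tiledCount κ R C (q * q) (q * q)) := by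
  have : NeZero q := ⟨hq.ne'⟩
  have hq' : (0 : ℝ) < q := by exact_mod_cast hq
  set U : Fin m → Fin n → ℕ := fun i j => marginCount κ (fun _ : Fin q × Fin q => q * t i j)
      (fun _ : Fin q × Fin q => q * t i j) with hU
  have h1 : ∀ i j, knomial κ (q * q) (q * t i j) ^ (q * q) ≤
      (q * t i j + 1) ^ (2 * q * (q * q)) * U i j := fun i j => knomial_le_uniform κ _ (hk i j)
  have hUpos : ∀ i j, 0 < U i j := fun i j => by
    by_contra h
    have h0 : U i j = 0 := by omega
    have := h1 i j
    rw [h0, mul_zero] at this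
    exact absurd (pow_pos (hk i j) (q * q)) (by omega)
  have h2 : ∀ i j, 1 / (q : ℝ) ^ 2 * Real.log (knomial κ (q * q) (q * t i j)) -
        2 * (Real.log (q * t i j + 1) / q) ≤ 1 / ((q * q : ℕ) : ℝ) ^ 2 * Real.log (U i j) := by
    intro i j
    have h3 : (knomial κ (q * q) (q * t i j) : ℝ) ^ (q * q) ≤
      ((q : ℝ) * t i j + 1) ^ (2 * q * (q * q)) * U i j := by exact_mod_cast h1 i j
    have h4 := Real.log_le_log (pow_pos (by exact_mod_cast hk i j) _) h3
    rw [Real.log_mul (by positivity) (by exact_mod_cast (hUpos i j).ne'), Real.log_pow,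
      Real.log_pow] at h4
    push_cast at h4 ⊢
    rw [one_div ((q * q : ℝ) ^ 2), le_inv_mul_iff₀ (by positivity)]
    calc _ = (q : ℝ) * q * Real.log (knomial κ (q * q) (q * t i j)) -
          2 * q * (q * q) * Real.log (q * t i j + 1) := by field_simp
      _ ≤ _ := by linarith
  have h5 := Real.log_le_log (x := ((∏ i, ∏ j, U i j : ℕ) : ℝ))
    (by exact_mod_cast Finset.prod_pos fun i _ => Finset.prod_pos fun j _ => hUpos i j)
    (Nat.cast_le.2 (prod_uniform_le_tiledCount κ t hR hC))
  have hne : ∀ i j, (U i j : ℝ) ≠ 0 := fun i j => by exact_mod_cast (hUpos i j).ne'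
  push_cast at h5
  rw [Real.log_prod fun i _ => Finset.prod_ne_zero_iff.2 fun j _ => hne i j] at h5
  simp_rw [Real.log_prod fun j _ => hne _ j] at h5
  refine le_trans ?_ (mul_le_mul_of_nonneg_left h5 (by positivity))
  rw [Finset.mul_sum]
  refine Finset.sum_le_sum fun i _ => ?_
  rw [Finset.mul_sum]
  exact Finset.sum_le_sum fun j _ => h2 i j

theorem tendsto_log_affine_div {c d : ℝ} (hc : 0 ≤ c) (hd : 0 < d) :
    Tendsto (fun p : ℕ => Real.log (c * (p : ℝ) ^ 2 + 1) / (d * p)) atTop (𝓝 0) := by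
  have h1 : Tendsto (fun x : ℝ => Real.log x / x) atTop (𝓝 0) := by
    simpa using Real.tendsto_pow_log_div_mul_add_atTop 1 0 1 one_ne_zero
  have h2 : Tendsto (fun p : ℕ => (c + 1) * (p : ℝ)) atTop atTop :=
    tendsto_natCast_atTop_atTop.const_mul_atTop (by linarith)
  have h3 := ((h1.comp h2).const_mul (2 * (c + 1) / d))
  rw [mul_zero] at h3
  refine tendsto_of_tendsto_of_tendsto_of_le_of_le' tendsto_const_nhds h3
    (Eventually.of_forall fun p => div_nonneg (Real.log_nonneg ?_) (by positivity)) ?_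
  · nlinarith [sq_nonneg (p : ℝ)]
  filter_upwards [eventually_ge_atTop 1] with p hp
  have hp' : (1 : ℝ) ≤ p := by exact_mod_cast hp
  have h4 : Real.log (c * (p : ℝ) ^ 2 + 1) ≤ Real.log (((c + 1) * p) ^ 2) := by
    apply Real.log_le_log (by positivity)
    nlinarith [mul_nonneg hc (sq_nonneg (p : ℝ)), mul_nonneg (mul_nonneg hc hc) (sq_nonneg (p : ℝ))]
  rw [Real.log_pow] at h4
  rw [div_le_iff₀ (by positivity)]
  refine h4.trans (le_of_eq ?_)
  simp only [Function.comp]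
  push_cast
  field_simp

/-- The independence table `R i * C j / N` bounds the growth rate of the table counts. -/
theorem sum_rate_le_of_tendsto {κ : ℕ∞} {R : Fin m → ℕ} {C : Fin n → ℕ} {N : ℕ} (hN : 0 < N)
    (hR : ∑ i, R i = N) (hC : ∑ j, C j = N) {L : ℝ}
    (hL : ∀ k : ℕ, 1 / (k : ℝ) ^ 2 * Real.log (tiledCount κ R C k k) ≤ L)
    {E : Fin m → Fin n → ℝ} (hk : ∀ s i j, 0 < knomial κ (s * N) (s * (R i * C j)))
    (hE : ∀ i j, Tendsto (fun s : ℕ => 1 / (s : ℝ) *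
      Real.log (knomial κ (s * N) (s * (R i * C j)))) atTop (𝓝 (N * E i j))) :
    ∑ i, ∑ j, E i j ≤ L := by
  have hN' : (0 : ℝ) < N := by exact_mod_cast hN
  -- With `q = N * p` and `t i j = p * (R i * C j)` the blocks are integral: `q * q` is `s * N` and
  -- `q * t i j` is `s * (R i * C j)` for `s = N * p ^ 2`. The average entry `t i j / q` is then
  -- exactly `R i * C j / N`.
  have hs : Tendsto (fun p : ℕ => N * p ^ 2) atTop atTop :=
    tendsto_atTop_mono (fun p => (Nat.le_self_pow two_ne_zero p).trans (Nat.le_mul_of_pos_left _ hN))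
      tendsto_id
  have hlim : Tendsto (fun p : ℕ => ∑ i, ∑ j, (1 / ((N * p : ℕ) : ℝ) ^ 2 *
        Real.log (knomial κ ((N * p) * (N * p)) ((N * p) * (p * (R i * C j)))) -
        2 * (Real.log ((N * p : ℕ) * (p * (R i * C j) : ℕ) + 1) / (N * p : ℕ)))) atTop
      (𝓝 (∑ i, ∑ j, E i j)) := by
    refine tendsto_finsetSum _ fun i _ => tendsto_finsetSum _ fun j _ => ?_
    have h1 := ((hE i j).comp hs).const_mul (1 / (N : ℝ))
    have h2 := (tendsto_log_affine_div (c := N * (R i * C j)) (d := N) (by positivity)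
      hN').const_mul 2
    have h3 := h1.sub h2
    convert h3 using 2 with p
    · simp only [Function.comp]
      have e1 : (N * p) * (N * p) = N * p ^ 2 * N := by ring
      have e2 : (N * p) * (p * (R i * C j)) = N * p ^ 2 * (R i * C j) := by ring
      rw [e1, e2]
      push_cast
      have e3 : (N : ℝ) * p * (p * (R i * C j)) + 1 = N * (R i * C j) * (p : ℝ) ^ 2 + 1 := by ring
      rw [e3]
      generalize Real.log (knomial κ (N * p ^ 2 * N) (N * p ^ 2 * (R i * C j))) = X
      ring
    · field_simp
      simp
  refine le_of_tendsto hlim ?_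
  filter_upwards [eventually_gt_atTop 0] with p hp
  refine (sum_log_knomial_le_log_tiledCount (Nat.mul_pos hN hp) (fun i j => p * (R i * C j))
    (fun i => ?_) (fun j => ?_) (fun i j => ?_)).trans (hL _)
  · rw [← Finset.mul_sum, ← Finset.mul_sum, hC]; ring
  · rw [← Finset.mul_sum, ← Finset.sum_mul, hR]; ring
  · convert hk (N * p ^ 2) i j using 2 <;> ring

end Tiling

/-! ### Cramér's theorem for the coefficients -/

theorem eventually_gt_lt_of_hasDerivAt_neg {f : ℝ → ℝ} {d x : ℝ} (hf : HasDerivAt f d x)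
    (hd : d < 0) : ∀ᶠ y in 𝓝[>] x, f y < f x := by
  have h := (hasDerivAt_iff_tendsto_slope.1 hf).mono_left
    (nhdsWithin_mono x fun y (hy : x < y) => hy.ne')
  filter_upwards [h.eventually_lt_const hd, self_mem_nhdsWithin] with y hy hxy
  rw [slope_def_field, div_lt_iff₀ (sub_pos.2 hxy)] at hy
  linarith

theorem eventually_lt_lt_of_hasDerivAt_pos {f : ℝ → ℝ} {d x : ℝ} (hf : HasDerivAt f d x)
    (hd : 0 < d) : ∀ᶠ y in 𝓝[<] x, f y < f x := by
  have h := (hasDerivAt_iff_tendsto_slope.1 hf).mono_left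
    (nhdsWithin_mono x fun y (hy : y < x) => hy.ne)
  filter_upwards [h.eventually_const_lt hd, self_mem_nhdsWithin] with y hy hxy
  have hxy' : y - x < 0 := sub_neg.2 hxy
  rw [slope_def_field, lt_div_iff_of_neg hxy'] at hy
  linarith

section Rate

variable {κ : ℕ∞} {F : ℝ → ℝ}

theorem knomial_gf_pos (hF : ∀ z ∈ Set.Ioo (0 : ℝ) 1,
    HasSum (fun t => (knomial κ 1 t : ℝ) * z ^ t) (F z)) {z : ℝ} (hz : z ∈ Set.Ioo (0 : ℝ) 1) :
    0 < F z := by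
  have h := knomial_mul_pow_le hz.1.le (hF z hz) 1 0
  have h1 : 0 < knomial κ 1 0 := knomial_pos (K := 0) (by simp) _ _ (by simp)
  have h2 : (0 : ℝ) < knomial κ 1 0 := by exact_mod_cast h1
  simp only [pow_zero, mul_one, pow_one] at h
  exact h2.trans_le h

/-- Up to a constant, the function is the logarithm of the Chernoff bound for a tail at `e` under
the extra tilt `θ`. Its slope at `θ = 1` is the mean `c` minus the threshold `e`, so a slight tilt
in the right direction gives exponential decay. -/
theorem hasDerivAt_tilt {z d : ℝ} (hFz : 0 < F z) (hd : HasDerivAt F d z) {n c e : ℕ}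
    (hmean : z * d * n = c * F z) :
    HasDerivAt (fun θ : ℝ => n * Real.log (F (z * θ)) - e * Real.log θ) (c - e) 1 := by
  have h1 : HasDerivAt (fun θ : ℝ => z * θ) z 1 := by
    simpa using (hasDerivAt_id (1 : ℝ)).const_mul z
  have h2 : HasDerivAt (fun θ : ℝ => F (z * θ)) (d * z) 1 := by
    have hd' : HasDerivAt F d (z * 1) := by rwa [mul_one]
    exact hd'.comp 1 h1
  have h3 := ((h2.log (by simpa using hFz.ne')).const_mul (n : ℝ)).sub
    ((Real.hasDerivAt_log (one_ne_zero)).const_mul (e : ℝ))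
  have h4 : (n : ℝ) * (d * z / F (z * 1)) - e * 1⁻¹ = c - e := by
    rw [mul_one]
    field_simp
    linarith
  rwa [h4] at h3

theorem tilt_ratio_lt_one {z θ : ℝ} (hFz : 0 < F z) (hFt : 0 < F (z * θ)) (hθ : 0 < θ) {n e : ℕ}
    (h : n * Real.log (F (z * θ)) - e * Real.log θ <
      n * Real.log (F (z * 1)) - e * Real.log 1) :
    F (z * θ) ^ n / (θ ^ e * F z ^ n) < 1 := by
  rw [div_lt_one (by positivity), ← Real.log_lt_log_iff (by positivity) (by positivity),
    Real.log_mul (by positivity) (by positivity), Real.log_pow, Real.log_pow, Real.log_pow]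
  simp only [mul_one, Real.log_one, mul_zero, sub_zero] at h
  linarith

/-- Concentration: some coefficient near the mean carries a non-negligible part of the total
weight. -/
theorem eventually_exists_knomial_ge (hF : ∀ z ∈ Set.Ioo (0 : ℝ) 1,
    HasSum (fun t => (knomial κ 1 t : ℝ) * z ^ t) (F z)) {z d : ℝ} (hz : z ∈ Set.Ioo (0 : ℝ) 1)
    (hd : HasDerivAt F d z) {n c : ℕ} (hmean : z * d * n = (c + 1 : ℕ) * F z) :
    ∀ᶠ p : ℕ in atTop, ∃ r, p * c ≤ r ∧ r ≤ p * (c + 2) ∧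
      F z ^ (p * n) ≤ 2 * (2 * p + 1) * (knomial κ (p * n) r * z ^ r) := by
  have hFz := knomial_gf_pos hF hz
  have e1 : ∀ᶠ θ : ℝ in 𝓝 1, z * θ ∈ Set.Ioo (0 : ℝ) 1 := by
    have : Tendsto (fun θ : ℝ => z * θ) (𝓝 1) (𝓝 (z * 1)) := tendsto_id.const_mul z
    refine this.eventually (Ioo_mem_nhds ?_ ?_) <;> simp [hz.1, hz.2]
  have e2 : ∀ᶠ θ : ℝ in 𝓝 1, 0 < θ := lt_mem_nhds one_pos
  -- The mean is `c + 1`: a tilt `θ > 1` controls the tail above `c + 2`, and a tilt `η < 1` the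
  -- tail below `c`.
  obtain ⟨θ, ⟨⟨hθd, hθz⟩, hθ0⟩, hθ1⟩ := (((eventually_gt_lt_of_hasDerivAt_neg
    (hasDerivAt_tilt hFz hd (e := c + 2) hmean) (by push_cast; linarith)).and
    (e1.filter_mono nhdsWithin_le_nhds)).and (e2.filter_mono nhdsWithin_le_nhds)).and
      self_mem_nhdsWithin |>.exists
  obtain ⟨η, ⟨⟨hηd, hηz⟩, hη0⟩, hη1⟩ := (((eventually_lt_lt_of_hasDerivAt_pos
    (hasDerivAt_tilt hFz hd (e := c) hmean) (by push_cast; linarith)).and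
    (e1.filter_mono nhdsWithin_le_nhds)).and (e2.filter_mono nhdsWithin_le_nhds)).and
      self_mem_nhdsWithin |>.exists
  have hFθ := knomial_gf_pos hF hθz
  have hFη := knomial_gf_pos hF hηz
  set ρ := F (z * θ) ^ n / (θ ^ (c + 2) * F z ^ n) with hρ
  set σ := F (z * η) ^ n / (η ^ c * F z ^ n) with hσ
  have hρ1 : ρ < 1 := tilt_ratio_lt_one hFz hFθ hθ0 hθd
  have hσ1 : σ < 1 := tilt_ratio_lt_one hFz hFη hη0 hηd
  have tρ := tendsto_pow_atTop_nhds_zero_of_lt_one (r := ρ) (by positivity) hρ1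
  have tσ := tendsto_pow_atTop_nhds_zero_of_lt_one (r := σ) (by positivity) hσ1
  filter_upwards [tρ.eventually_lt_const (show (0 : ℝ) < 1 / 4 by norm_num),
    tσ.eventually_lt_const (show (0 : ℝ) < 1 / 4 by norm_num)] with p hp1 hp2
  by_contra! hcon
  set W := Finset.Icc (p * c) (p * (c + 2)) with hW
  set M := F z ^ (p * n) / (2 * (2 * p + 1)) with hM
  have hM0 : 0 ≤ M := by positivity
  have s0 := hasSum_knomial (hF z hz) (p * n)
  have s1 := (hasSum_knomial (hF _ hθz) (p * n)).div_const (θ ^ (p * (c + 2)))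
  have s2 := (hasSum_knomial (hF _ hηz) (p * n)).div_const (η ^ (p * c))
  have s3 : HasSum (fun r => if r ∈ W then M else 0) (∑ r ∈ W, if r ∈ W then M else 0) :=
    hasSum_sum_of_ne_finset_zero fun r hr => if_neg hr
  -- Every term is dominated by `M` in the window or by a tilted term outside it. The window
  -- contributes half of the total `F z ^ (p * n)` and each tail less than a quarter, a
  -- contradiction.
  have h := hasSum_le (fun r => ?_) s0 ((s3.add s1).add s2)
  · have w1 : ∑ r ∈ W, (if r ∈ W then M else 0) = F z ^ (p * n) / 2 := by
      rw [Finset.sum_congr rfl fun r hr => if_pos hr, Finset.sum_const, hW, Nat.card_Icc,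
        nsmul_eq_mul, hM]
      have : p * (c + 2) + 1 - p * c = 2 * p + 1 := by
        rw [mul_add]; omega
      rw [this]
      push_cast
      field_simp
    have w2 : F (z * θ) ^ (p * n) / θ ^ (p * (c + 2)) = ρ ^ p * F z ^ (p * n) := by
      rw [hρ, div_pow, mul_pow, ← pow_mul, ← pow_mul, ← pow_mul]
      field_simp
      ring
    have w3 : F (z * η) ^ (p * n) / η ^ (p * c) = σ ^ p * F z ^ (p * n) := by
      rw [hσ, div_pow, mul_pow, ← pow_mul, ← pow_mul, ← pow_mul]
      field_simp
      ring
    rw [w1, w2, w3] at h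
    have hpos : 0 < F z ^ (p * n) := by positivity
    nlinarith
  · have n1 : 0 ≤ (knomial κ (p * n) r : ℝ) * (z * θ) ^ r / θ ^ (p * (c + 2)) := by
      have := hθz.1; positivity
    have n2 : 0 ≤ (knomial κ (p * n) r : ℝ) * (z * η) ^ r / η ^ (p * c) := by
      have := hηz.1; positivity
    have n0 : 0 ≤ (knomial κ (p * n) r : ℝ) * z ^ r := by have := hz.1; positivity
    by_cases hr1 : r < p * c
    · have : (knomial κ (p * n) r : ℝ) * z ^ r ≤
          (knomial κ (p * n) r : ℝ) * (z * η) ^ r / η ^ (p * c) := by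
        rw [le_div_iff₀ (by positivity), mul_pow, ← mul_assoc]
        exact mul_le_mul_of_nonneg_left (pow_le_pow_of_le_one hη0.le hη1.le hr1.le) n0
      have : 0 ≤ if r ∈ W then M else 0 := by split_ifs <;> simp [hM0]
      linarith
    by_cases hr2 : p * (c + 2) < r
    · have : (knomial κ (p * n) r : ℝ) * z ^ r ≤
          (knomial κ (p * n) r : ℝ) * (z * θ) ^ r / θ ^ (p * (c + 2)) := by
        rw [le_div_iff₀ (by positivity), mul_pow, ← mul_assoc]
        exact mul_le_mul_of_nonneg_left (pow_le_pow_right₀ hθ1.le hr2.le) n0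
      have : 0 ≤ if r ∈ W then M else 0 := by split_ifs <;> simp [hM0]
      linarith
    · have hrW : r ∈ W := by rw [hW, Finset.mem_Icc]; omega
      rw [if_pos hrW]
      have : (knomial κ (p * n) r : ℝ) * z ^ r ≤ M := by
        rw [hM, le_div_iff₀ (by positivity), mul_comm]
        exact (hcon r (by omega) (by omega)).le
      linarith

/-- Cramér's theorem for the coefficients of `(1 + x + ⋯ + x ^ κ) ^ n`. -/
theorem tendsto_log_knomial {K : ℕ} (hK : (K : ℕ∞) ≤ κ) (hF : ∀ z ∈ Set.Ioo (0 : ℝ) 1,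
    HasSum (fun t => (knomial κ 1 t : ℝ) * z ^ t) (F z)) {z d : ℝ} (hz : z ∈ Set.Ioo (0 : ℝ) 1)
    (hd : HasDerivAt F d z) {n r : ℕ} (hr : 0 < r) (hrK : r < K * n)
    (hmean : z * d * n = r * F z) :
    Tendsto (fun s : ℕ => 1 / (s : ℝ) * Real.log (knomial κ (s * n) (s * r))) atTop
      (𝓝 (n * Real.log (F z) - r * Real.log z)) := by
  have hFz := knomial_gf_pos hF hz
  set G := n * Real.log (F z) - r * Real.log z with hG
  have hpos : ∀ s, (0 : ℝ) < knomial κ (s * n) (s * r) := fun s => by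
    have : 0 < knomial κ (s * n) (s * r) := knomial_pos hK _ _ (by nlinarith)
    exact_mod_cast this
  have hub : ∀ s : ℕ, Real.log (knomial κ (s * n) (s * r)) ≤ s * G := fun s => by
    have h := knomial_mul_pow_le hz.1.le (hF z hz) (s * n) (s * r)
    have h1 := Real.log_le_log (mul_pos (hpos s) (pow_pos hz.1 _)) h
    rw [Real.log_mul (hpos s).ne' (pow_pos hz.1 _).ne', Real.log_pow, Real.log_pow] at h1
    push_cast at h1
    rw [hG]
    linarith
  have hsub : Subadditive fun s : ℕ => -Real.log (knomial κ (s * n) (s * r)) := fun a b => by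
    have h : (knomial κ (a * n) (a * r) : ℝ) * knomial κ (b * n) (b * r) ≤
        knomial κ ((a + b) * n) ((a + b) * r) := by
      rw [add_mul, add_mul]; exact_mod_cast knomial_mul_le κ _ _ _ _
    have h1 := Real.log_le_log (mul_pos (hpos a) (hpos b)) h
    rw [Real.log_mul (hpos a).ne' (hpos b).ne'] at h1
    linarith
  have hbdd : BddBelow (Set.range fun s : ℕ => -Real.log (knomial κ (s * n) (s * r)) / s) := by
    refine ⟨-|G|, ?_⟩
    rintro _ ⟨s, rfl⟩
    rcases Nat.eq_zero_or_pos s with rfl | hs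
    · simp
    have hs' : (0 : ℝ) < s := by exact_mod_cast hs
    have h1 := hub s
    have h2 := mul_le_mul_of_nonneg_left (le_abs_self G) hs'.le
    rw [le_div_iff₀ hs']
    linarith
  have hlim := (hsub.tendsto_lim hbdd).neg
  set L := -hsub.lim with hL
  have hle : ∀ s : ℕ, Real.log (knomial κ (s * n) (s * r)) ≤ s * L := fun s => by
    rcases Nat.eq_zero_or_pos s with rfl | hs
    · simp [knomial_zero]
    have hs' : (0 : ℝ) < s := by exact_mod_cast hs
    have h := hsub.lim_le_div hbdd hs.ne'
    rw [le_div_iff₀ hs'] at h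
    rw [hL]
    linarith
  have hlim' : Tendsto (fun s : ℕ => 1 / (s : ℝ) * Real.log (knomial κ (s * n) (s * r))) atTop
      (𝓝 L) := by
    refine hlim.congr fun s => ?_
    ring
  have hLG : L ≤ G := by
    refine le_of_tendsto hlim' ?_
    filter_upwards [eventually_gt_atTop 0] with s hs
    have hs' : (0 : ℝ) < s := by exact_mod_cast hs
    rw [one_div, inv_mul_le_iff₀ hs']
    exact hub s
  -- Concentration only locates a heavy coefficient `r'` within `p` of `p * (Q * r)`. Multiplying by
  -- `p * n` more factors moves it to exactly `p * (Q + 1) * r`: the missing amount lies between `p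
  -- * (r - 1)` and `p * (r + 1)`, which is attainable because `0 < r < K * n`. This padding is
  -- negligible as `Q` grows.
  have hkey : ∀ Q : ℕ, 0 < Q → Q * G + Real.log z ≤ (Q + 1) * L := by
    intro Q hQ
    have hQr : 0 < Q * r := Nat.mul_pos hQ hr
    obtain ⟨c, hc⟩ : ∃ c, Q * r = c + 1 := ⟨Q * r - 1, by omega⟩
    have hm : z * d * (Q * n : ℕ) = (c + 1 : ℕ) * F z := by
      rw [← hc]
      push_cast
      linear_combination (Q : ℝ) * hmean
    have hcon := eventually_exists_knomial_ge hF hz hd hm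
    have hl0 : Tendsto (fun p : ℕ => Real.log (4 * p + 2) / (p : ℝ)) atTop (𝓝 0) := by
      have h1 : Tendsto (fun x : ℝ => Real.log x / (4⁻¹ * x + -(2⁻¹))) atTop (𝓝 0) := by
        simpa using Real.tendsto_pow_log_div_mul_add_atTop 4⁻¹ (-(2⁻¹)) 1 (by norm_num)
      have h2 : Tendsto (fun p : ℕ => 4 * (p : ℝ) + 2) atTop atTop :=
        tendsto_atTop_add_const_right _ _
          (tendsto_natCast_atTop_atTop.const_mul_atTop (by norm_num))
      refine (h1.comp h2).congr fun p => ?_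
      simp only [Function.comp]
      congr 1
      ring
    have hl1 : Tendsto (fun p : ℕ => Q * G + Real.log z - Real.log (4 * p + 2) / (p : ℝ)) atTop
        (𝓝 (Q * G + Real.log z - 0)) := tendsto_const_nhds.sub hl0
    rw [sub_zero] at hl1
    refine le_of_tendsto hl1 ?_
    filter_upwards [hcon, eventually_gt_atTop 0] with p ⟨r', hr1, hr2, hr3⟩ hp
    have hp' : (0 : ℝ) < p := by exact_mod_cast hp
    have hk : knomial κ (p * (Q * n)) r' ≤ knomial κ ((p * (Q + 1)) * n) ((p * (Q + 1)) * r) := by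
      have a1 : p * (Q + 1) * r = p * (c + 1) + p * r := by rw [← hc]; ring
      have a2 : p * (c + 2) = p * (c + 1) + p := by ring
      have a3 : p * (c + 1) = p * c + p := by ring
      have a4 : p ≤ p * r := Nat.le_mul_of_pos_right _ hr
      have a5 : p * (r + 1) ≤ p * (K * n) := Nat.mul_le_mul_left _ hrK
      have a6 : p * (r + 1) = p * r + p := by ring
      have a7 : K * (p * n) = p * (K * n) := by ring
      have h1 := knomial_mul_le κ (p * (Q * n)) (p * n) r' (p * (Q + 1) * r - r')
      have h2 : 0 < knomial κ (p * n) (p * (Q + 1) * r - r') := by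
        refine knomial_pos hK _ _ ?_
        rw [a7]
        omega
      have e1 : p * (Q * n) + p * n = p * (Q + 1) * n := by ring
      have e2 : r' + (p * (Q + 1) * r - r') = p * (Q + 1) * r := by omega
      rw [e1, e2] at h1
      exact (Nat.le_mul_of_pos_right _ h2).trans h1
    have hk' : (knomial κ (p * (Q * n)) r' : ℝ) ≤
      knomial κ ((p * (Q + 1)) * n) ((p * (Q + 1)) * r) := by exact_mod_cast hk
    have hzr : 0 < z ^ r' := pow_pos hz.1 _
    have h4 : F z ^ (p * (Q * n)) ≤ (4 * p + 2) *
        (knomial κ ((p * (Q + 1)) * n) ((p * (Q + 1)) * r) * z ^ r') := by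
      refine hr3.trans ?_
      have : (2 : ℝ) * (2 * p + 1) = 4 * p + 2 := by ring
      rw [this]
      gcongr
    have h5 := Real.log_le_log (pow_pos hFz _) h4
    rw [Real.log_mul (by positivity) (mul_pos (hpos _) hzr).ne',
      Real.log_mul (hpos _).ne' hzr.ne', Real.log_pow, Real.log_pow] at h5
    have h6 := hle (p * (Q + 1))
    have hz0 : Real.log z ≤ 0 := Real.log_nonpos hz.1.le hz.2.le
    have h7 : (r' : ℝ) * Real.log z ≤ (p * (Q * r) - p) * Real.log z := by
      refine mul_le_mul_of_nonpos_right ?_ hz0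
      have hcc : (Q : ℝ) * r = c + 1 := by exact_mod_cast hc
      have : (p : ℝ) * c ≤ r' := by exact_mod_cast hr1
      rw [hcc]
      linarith
    push_cast at h5 h6
    have h8 : p * (Q * G + Real.log z) - Real.log (4 * p + 2) ≤ p * ((Q + 1) * L) := by
      rw [hG]
      linarith
    have h9 : Q * G + Real.log z - Real.log (4 * p + 2) / p =
        (p * (Q * G + Real.log z) - Real.log (4 * p + 2)) / p := by field_simp
    rw [h9, div_le_iff₀ hp']
    linarith
  have hGL : G ≤ L := by
    by_contra! h
    obtain ⟨Q, hQ⟩ := exists_nat_gt (max 0 ((L - Real.log z) / (G - L)))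
    have hQ0 : (0 : ℝ) < Q := (le_max_left _ _).trans_lt hQ
    have hQ1 := (le_max_right _ _).trans_lt hQ
    rw [div_lt_iff₀ (by linarith)] at hQ1
    have := hkey Q (by exact_mod_cast hQ0)
    linarith
  rwa [le_antisymm hLG hGL] at hlim'

end Rate

/-! ### Charts of the entropy near mean zero -/

theorem strictConvexOn_of_hasDerivAt2 {D : Set ℝ} (hD : Convex ℝ D) {f f' f'' : ℝ → ℝ}
    (hf : ContinuousOn f D) (hf' : ∀ x ∈ interior D, HasDerivAt f (f' x) x)
    (hf'' : ∀ x ∈ interior D, HasDerivAt f' (f'' x) x)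
    (hpos : ∀ x ∈ interior D, 0 < f'' x) : StrictConvexOn ℝ D f := by
  refine strictConvexOn_of_deriv2_pos hD hf fun x hx => ?_
  have h : deriv f =ᶠ[𝓝 x] f' := by
    filter_upwards [isOpen_interior.mem_nhds hx] with y hy using (hf' y hy).deriv
  change 0 < deriv (deriv f) x
  rw [h.deriv_eq, (hf'' x hx).deriv]
  exact hpos x hx

/-- The local entropy `h x - x * log x` of the uniform distribution on `{0, …, κ}` tilted to the
mean `x ∈ (0, b)`; `z x` is the tilting parameter and `F` the generating function. -/
structure EntropyChart (κ : ℕ∞) (b : ℝ) where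
  F : ℝ → ℝ
  z : ℝ → ℝ
  d : ℝ → ℝ
  h : ℝ → ℝ
  h' : ℝ → ℝ
  h'' : ℝ → ℝ
  K : ℕ
  K_le : (K : ℕ∞) ≤ κ
  b_le : b ≤ K
  hasSum_F : ∀ z ∈ Set.Ioo (0 : ℝ) 1, HasSum (fun t => (knomial κ 1 t : ℝ) * z ^ t) (F z)
  z_mem : ∀ x ∈ Set.Ioo 0 b, z x ∈ Set.Ioo (0 : ℝ) 1
  hasDerivAt_F : ∀ x ∈ Set.Ioo 0 b, HasDerivAt F (d x) (z x)
  mean_eq : ∀ x ∈ Set.Ioo 0 b, z x * d x = x * F (z x)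
  h_eq : ∀ x ∈ Set.Ioo 0 b, h x = Real.log (F (z x)) - x * Real.log (z x) + x * Real.log x
  h_zero : h 0 = 0
  continuousOn_h : ContinuousOn h (Set.Ico 0 b)
  hasDerivAt_h : ∀ x ∈ Set.Ioo 0 b, HasDerivAt h (h' x) x
  hasDerivAt_h' : ∀ x ∈ Set.Ioo 0 b, HasDerivAt h' (h'' x) x
  strictConvexOn : StrictConvexOn ℝ (Set.Ico 0 b) fun x => x ^ 2 * h'' x

/-- Up to the affine term `x - 1` the function is `(1 + x)⁻¹`. As `b` is arbitrary, the case `κ = ⊤`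
needs no smallness of the means. -/
theorem strictConvexOn_sq_div_one_add (b : ℝ) :
    StrictConvexOn ℝ (Set.Ico 0 b) fun x : ℝ => x ^ 2 * (1 + x)⁻¹ := by
  have hpos : ∀ x ∈ Set.Ico 0 b, 1 + x ≠ 0 := fun x hx => by have := hx.1; positivity
  have hD : ∀ x : ℝ, HasDerivAt (fun x : ℝ => 1 + x) 1 x := fun x => (hasDerivAt_id x).const_add 1
  have h1 : StrictConvexOn ℝ (Set.Ico 0 b) fun x : ℝ => x - 1 + (1 + x)⁻¹ := by
    refine strictConvexOn_of_hasDerivAt2 (convex_Ico 0 b) (f' := fun x => 1 + -1 / (1 + x) ^ 2)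
      (f'' := fun x => 2 / (1 + x) ^ 3) ?_ ?_ ?_ ?_
    · exact (continuousOn_id.sub continuousOn_const).add
        (ContinuousOn.inv₀ (by fun_prop) hpos)
    · intro x hx
      exact ((hasDerivAt_id x).sub_const 1).add ((hD x).inv (hpos x (interior_subset hx)))
    · intro x hx
      have hx0 := hpos x (interior_subset hx)
      have h := (((hD x).pow 2).inv (pow_ne_zero 2 hx0)).const_mul (-1)
      have h2 := h.const_add 1
      have e1 : (fun x : ℝ => 1 + -1 * ((fun x : ℝ => 1 + x) ^ 2)⁻¹ x) =
          fun x => 1 + -1 / (1 + x) ^ 2 := by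
        funext y; simp [div_eq_mul_inv]
      have e2 : (-1 : ℝ) * (-(((2 : ℕ) : ℝ) * (1 + x) ^ (2 - 1) * 1) / ((1 + x) ^ 2) ^ 2) =
          2 / (1 + x) ^ 3 := by field_simp; norm_num; ring
      rw [← e2]
      exact h2.congr_of_eventuallyEq (Eventually.of_forall fun y => (congrFun e1 y).symm)
    · intro x hx
      have := (interior_subset hx).1
      positivity
  refine h1.congr fun x hx => ?_
  have := hpos x hx
  field_simp
  ring

/-- The entropy of the geometric distribution. -/
theorem nonempty_entropyChart_top (b : ℝ) : Nonempty (EntropyChart ⊤ b) := by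
  have hD : ∀ x : ℝ, HasDerivAt (fun x : ℝ => 1 + x) 1 x := fun x => (hasDerivAt_id x).const_add 1
  obtain ⟨K, hK⟩ := exists_nat_ge b
  have hz : ∀ x ∈ Set.Ioo 0 b, x / (1 + x) ∈ Set.Ioo (0 : ℝ) 1 := fun x hx => by
    have := hx.1
    exact ⟨by positivity, by rw [div_lt_one (by positivity)]; linarith⟩
  have h1z : ∀ x ∈ Set.Ioo 0 b, 1 - x / (1 + x) = (1 + x)⁻¹ := fun x hx => by
    have := hx.1; field_simp; ring
  refine ⟨{
    F := fun z => (1 - z)⁻¹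
    z := fun x => x / (1 + x)
    d := fun x => (1 + x) ^ 2
    h := fun x => (1 + x) * Real.log (1 + x)
    h' := fun x => Real.log (1 + x) + 1
    h'' := fun x => (1 + x)⁻¹
    K := K
    K_le := le_top
    b_le := hK
    hasSum_F := fun z hz => hasSum_knomial_one_top hz.1.le hz.2
    z_mem := hz
    hasDerivAt_F := fun x hx => ?_
    mean_eq := fun x hx => ?_
    h_eq := fun x hx => ?_
    h_zero := by simp
    continuousOn_h := ?_
    hasDerivAt_h := fun x hx => ?_
    hasDerivAt_h' := fun x hx => ?_
    strictConvexOn := strictConvexOn_sq_div_one_add b }⟩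
  · have hx0 := hx.1
    have h := (((hasDerivAt_id (x / (1 + x))).const_sub 1).inv
      (by simp only [id]; rw [h1z x hx]; positivity))
    simp only [id] at h
    rw [h1z x hx] at h
    have e : -(-1 : ℝ) / ((1 + x)⁻¹) ^ 2 = (1 + x) ^ 2 := by simp
    rw [e] at h
    exact h
  · have hx0 := hx.1
    simp only [h1z x hx]
    field_simp
  · have hx0 := hx.1
    simp only [h1z x hx, inv_inv]
    rw [Real.log_div hx0.ne' (by positivity)]
    ring
  · have hc : ContinuousOn (fun x : ℝ => 1 + x) (Set.Ico 0 b) := by fun_prop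
    exact hc.mul (hc.log fun x hx => by have := hx.1; positivity)
  · have hx0 : 1 + x ≠ 0 := by have := hx.1; positivity
    have h := (hD x).mul ((hD x).log hx0)
    have e : 1 * Real.log (1 + x) + (1 + x) * (1 / (1 + x)) = Real.log (1 + x) + 1 := by
      field_simp
    rw [e] at h
    exact h
  · have hx0 : 1 + x ≠ 0 := by have := hx.1; positivity
    have h := ((hD x).log hx0).add_const 1
    rw [one_div] at h
    exact h

/-- Analytic inversion of `z ↦ z * G z` at the origin. -/
theorem exists_analytic_inverse {G : ℝ → ℝ} (hG : AnalyticAt ℝ G 0) (hG0 : G 0 = 1) :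
    ∃ Z : ℝ → ℝ, AnalyticAt ℝ Z 0 ∧ Z 0 = 0 ∧ deriv Z 0 = 1 ∧
      ∀ᶠ x in 𝓝 0, Z x * G (Z x) = x := by
  have hA : AnalyticAt ℝ (fun z => z * G z) 0 := analyticAt_id.mul hG
  have hd : HasDerivAt (fun z => z * G z) 1 0 := by
    have h : HasDerivAt (fun z => z * G z) (1 * G 0 + 0 * deriv G 0) 0 :=
      (hasDerivAt_id (0 : ℝ)).mul hG.differentiableAt.hasDerivAt
    simpa [hG0] using h
  have hne : deriv (fun z => z * G z) 0 ≠ 0 := by rw [hd.deriv]; exact one_ne_zero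
  have e0 : (0 : ℝ) * G 0 = 0 := zero_mul _
  have h1 := hA.analyticAt_localInverse hne
  have h2 := hA.hasStrictDerivAt.to_localInverse hne
  have h3 := hA.hasStrictDerivAt.eventually_right_inverse hne
  have h4 : hA.hasStrictDerivAt.localInverse _ _ _ hne ((0 : ℝ) * G 0) = 0 :=
    HasStrictFDerivAt.localInverse_apply_image ..
  simp only [e0] at h1 h2 h3 h4
  refine ⟨_, h1, h4, ?_, h3⟩
  rw [h2.hasDerivAt.deriv, hd.deriv, inv_one]

/-- `x ^ 2 * f x` is strictly convex near a point where an analytic `f` is positive. -/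
theorem exists_strictConvexOn_sq_mul {f : ℝ → ℝ} (hf : AnalyticAt ℝ f 0) (h0 : 0 < f 0) :
    ∃ ε > 0, ∀ b ≤ ε, StrictConvexOn ℝ (Set.Ico 0 b) fun x => x ^ 2 * f x := by
  have hφ : AnalyticAt ℝ (fun x => x ^ 2 * f x) 0 := (analyticAt_id.pow 2).mul hf
  have hev : ∀ᶠ x in 𝓝 (0 : ℝ), AnalyticAt ℝ (fun x => x ^ 2 * f x) x := hφ.eventually_analyticAt
  have hd1 : ∀ᶠ x in 𝓝 (0 : ℝ), deriv (fun x => x ^ 2 * f x) x = 2 * x * f x + x ^ 2 * deriv f x := by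
    filter_upwards [hf.eventually_analyticAt] with x hx
    have h := ((hasDerivAt_id x).pow 2).mul hx.differentiableAt.hasDerivAt
    have h2 := h.deriv
    simp only [id, Nat.cast_ofNat, Nat.add_one_sub_one, pow_one, mul_one] at h2
    exact h2
  -- Only the factor `x ^ 2` contributes at the origin, so positivity of `f 0` suffices.
  have hd2 : deriv (deriv fun x => x ^ 2 * f x) 0 = 2 * f 0 := by
    rw [EventuallyEq.deriv_eq hd1]
    have h := (((hasDerivAt_id (0 : ℝ)).const_mul 2).mul hf.differentiableAt.hasDerivAt).add
      (((hasDerivAt_id (0 : ℝ)).pow 2).mul hf.deriv.differentiableAt.hasDerivAt)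
    have h2 := h.deriv
    simp at h2
    exact h2
  have hpos : ∀ᶠ x in 𝓝 (0 : ℝ), 0 < deriv (deriv fun x => x ^ 2 * f x) x :=
    hφ.deriv.deriv.continuousAt.eventually (lt_mem_nhds (by rw [hd2]; linarith))
  obtain ⟨ε, hε, hball⟩ := Metric.eventually_nhds_iff.1 (hev.and hpos)
  have hmem : ∀ b ≤ ε, ∀ x ∈ Set.Ico 0 b, dist x 0 < ε := fun b hb x hx => by
    rw [Real.dist_eq, sub_zero, abs_of_nonneg hx.1]; exact hx.2.trans_le hb
  refine ⟨ε, hε, fun b hb => strictConvexOn_of_hasDerivAt2 (convex_Ico 0 b)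
    (fun x hx => (hball (hmem b hb x hx)).1.continuousAt.continuousWithinAt)
    (fun x hx => (hball (hmem b hb x (interior_subset hx))).1.differentiableAt.hasDerivAt)
    (fun x hx => (hball (hmem b hb x (interior_subset hx))).1.deriv.differentiableAt.hasDerivAt)
    (fun x hx => (hball (hmem b hb x (interior_subset hx))).2)⟩

/-- Entropy charts exist near the origin for a generating function `1 + z + z ^ 2 + O(z ^ 3)`. -/
theorem exists_entropyChart_nat {K : ℕ} (hK : 2 ≤ K) :
    ∃ b : ℝ, 0 < b ∧ Nonempty (EntropyChart K b) := by
  -- This is where `2 ≤ K` matters: the quadratic coefficient of `F` is 1.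
  obtain ⟨k, rfl⟩ : ∃ k, K = k + 2 := ⟨K - 2, by omega⟩
  set F : ℝ → ℝ := fun z => ∑ t ∈ Finset.range (k + 2 + 1), z ^ t with hF
  set P : ℝ → ℝ := fun z => ∑ t ∈ Finset.range k, z ^ t with hP
  have hPan : ∀ x, AnalyticAt ℝ P x := fun x => by
    refine Finset.analyticAt_fun_sum _ fun t _ => analyticAt_id.pow t
  have hFP : F = fun z => 1 + z + z ^ 2 + z ^ 3 * P z := by
    funext z
    simp only [hF, hP, Finset.sum_range_succ', Finset.mul_sum, pow_add]
    ring_nf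
  set F' : ℝ → ℝ := fun z => 1 + 2 * z + (3 * z ^ 2 * P z + z ^ 3 * deriv P z) with hF'
  have hFd : ∀ z, HasDerivAt F (F' z) z := fun z => by
    rw [hFP]
    have h := (((hasDerivAt_id z).const_add 1).add ((hasDerivAt_id z).pow 2)).add
      (((hasDerivAt_id z).pow 3).mul (hPan z).differentiableAt.hasDerivAt)
    have e : (1 + ((2 : ℕ) : ℝ) * id z ^ (2 - 1) * 1 + (((3 : ℕ) : ℝ) * id z ^ (3 - 1) * 1 * P z +
        (id ^ 3) z * deriv P z)) = F' z := by
      simp [hF']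
    rw [e] at h
    exact h
  have hFan : AnalyticAt ℝ F 0 := by
    rw [hFP]
    exact ((analyticAt_const.add analyticAt_id).add (analyticAt_id.pow 2)).add
      ((analyticAt_id.pow 3).mul (hPan 0))
  have hF'an : AnalyticAt ℝ F' 0 :=
    (analyticAt_const.add (analyticAt_const.mul analyticAt_id)).add
      (((analyticAt_const.mul (analyticAt_id.pow 2)).mul (hPan 0)).add
        ((analyticAt_id.pow 3).mul (hPan 0).deriv))
  have hF0 : F 0 = 1 := by simp [hFP]
  have hF'0 : F' 0 = 1 := by simp [hF']
  have hF''0 : HasDerivAt F' 2 0 := by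
    have h := (((hasDerivAt_id (0 : ℝ)).const_mul 2).const_add 1).add
      (((((hasDerivAt_id (0 : ℝ)).pow 2).const_mul 3).mul (hPan 0).differentiableAt.hasDerivAt).add
        (((hasDerivAt_id (0 : ℝ)).pow 3).mul (hPan 0).deriv.differentiableAt.hasDerivAt))
    have h2 := h.deriv
    simp at h2
    have h3 := hF'an.differentiableAt.hasDerivAt
    have h4 : deriv F' 0 = 2 := h2
    rwa [h4] at h3
  -- The mean at tilting parameter `z` is `z * G z`, which is inverted near 0.
  set G : ℝ → ℝ := fun z => F' z / F z with hG
  have hGan : AnalyticAt ℝ G 0 := hF'an.div hFan (by rw [hF0]; exact one_ne_zero)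
  have hG0 : G 0 = 1 := by simp [hG, hF0, hF'0]
  -- The value is F''(0) − F'(0)² = 2 − 1, and it becomes h''(0) = 1 below. For entries bounded by 1
  -- it would be −1.
  have hGd : deriv G 0 = 1 := by
    have h := (hF''0.div (hFd 0) (by rw [hF0]; exact one_ne_zero)).deriv
    rw [hF0, hF'0] at h
    norm_num at h
    exact h
  obtain ⟨Z, hZan, hZ0, hZd, hZ⟩ := exists_analytic_inverse hGan hG0
  have hGZan : AnalyticAt ℝ (fun x => G (Z x)) 0 := by
    have : AnalyticAt ℝ G (Z 0) := by rwa [hZ0]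
    exact this.comp hZan
  have hLan : AnalyticAt ℝ (fun x => Real.log (G (Z x))) 0 :=
    hGZan.log (by rw [hZ0, hG0]; exact one_pos)
  have hLd : deriv (fun x => Real.log (G (Z x))) 0 = 1 := by
    have h1 : HasDerivAt Z 1 0 := by
      have := hZan.differentiableAt.hasDerivAt
      rwa [hZd] at this
    have h2 : HasDerivAt G 1 (Z 0) := by
      have := hGan.differentiableAt.hasDerivAt
      rwa [hGd, ← hZ0] at this
    have h3 := (h2.comp 0 h1).log (by simp [hZ0, hG0])
    have h4 := h3.deriv
    simp only [Function.comp, hZ0, hG0] at h4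
    norm_num at h4
    exact h4
  obtain ⟨ε, hε, hconv⟩ := exists_strictConvexOn_sq_mul hLan.deriv (by rw [hLd]; exact one_pos)
  have hZt : Tendsto Z (𝓝 0) (𝓝 0) := by
    have := hZan.continuousAt.tendsto
    rwa [hZ0] at this
  have hev : ∀ᶠ x in 𝓝 (0 : ℝ), (AnalyticAt ℝ Z x ∧ AnalyticAt ℝ G (Z x) ∧
      AnalyticAt ℝ (fun x => Real.log (G (Z x))) x) ∧ 0 < G (Z x) ∧ 0 < F (Z x) ∧ Z x < 1 ∧
      Z x * G (Z x) = x ∧ ∀ᶠ y in 𝓝 x, Z y * G (Z y) = y := by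
    filter_upwards [hZan.eventually_analyticAt, hZt.eventually hGan.eventually_analyticAt,
      hLan.eventually_analyticAt,
      hZt.eventually (hGan.continuousAt.eventually (lt_mem_nhds (by rw [hG0]; exact one_pos))),
      hZt.eventually (hFan.continuousAt.eventually (lt_mem_nhds (by rw [hF0]; exact one_pos))),
      hZt.eventually (gt_mem_nhds one_pos), hZ, hZ.eventually_nhds] with x h1 h2 h3 h4 h5 h6 h7 h8
    exact ⟨⟨h1, h2, h3⟩, h4, h5, h6, h7, h8⟩
  obtain ⟨η, hη, hball⟩ := Metric.eventually_nhds_iff.1 hev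
  set b := min (min ε η) 1 with hb
  have hbε : b ≤ ε := (min_le_left _ _).trans (min_le_left _ _)
  have hbη : b ≤ η := (min_le_left _ _).trans (min_le_right _ _)
  have hmem : ∀ x ∈ Set.Ico 0 b, dist x 0 < η := fun x hx => by
    rw [Real.dist_eq, sub_zero, abs_of_nonneg hx.1]; exact hx.2.trans_le hbη
  have hfact := fun x hx => hball (hmem x hx)
  have hsub : Set.Ioo 0 b ⊆ Set.Ico 0 b := Set.Ioo_subset_Ico_self
  have hZpos : ∀ x ∈ Set.Ioo 0 b, 0 < Z x := fun x hx => by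
    obtain ⟨-, h1, -, -, h2, -⟩ := hfact x (hsub hx)
    have : 0 < Z x * G (Z x) := by rw [h2]; exact hx.1
    exact pos_of_mul_pos_left this h1.le
  -- Since `x / Z x = G (Z x)`, adding `x * log x` to the entropy replaces the singular `-x * log (Z
  -- x)` by `x * log (G (Z x))`, analytic at 0.
  have hder : ∀ x ∈ Set.Ico 0 b, HasDerivAt
      (fun x => Real.log (F (Z x)) + x * Real.log (G (Z x))) (Real.log (G (Z x)) + 1) x := by
    intro x hx
    obtain ⟨⟨hZx, hGx, hLx⟩, hGpos, hFpos, -, hx1, hx2⟩ := hfact x hx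
    have a1 := hZx.differentiableAt.hasDerivAt
    have a2 := hGx.differentiableAt.hasDerivAt
    have a3 : HasDerivAt (fun x => F (Z x)) (F' (Z x) * deriv Z x) x := (hFd (Z x)).comp x a1
    have a4 : HasDerivAt (fun x => G (Z x)) (deriv G (Z x) * deriv Z x) x := a2.comp x a1
    have a5 := (a3.log hFpos.ne').add ((hasDerivAt_id x).mul (a4.log hGpos.ne'))
    -- The inverse relation `Z x * G (Z x) = x`, differentiated.
    have a6 : deriv Z x * G (Z x) + Z x * (deriv G (Z x) * deriv Z x) = 1 := by
      have h := a1.mul a4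
      have h' : HasDerivAt (fun y => Z y * G (Z y)) 1 x :=
        (hasDerivAt_id x).congr_of_eventuallyEq hx2
      exact h.unique h'
    have e : F' (Z x) * deriv Z x / F (Z x) + (1 * Real.log (G (Z x)) +
        id x * (deriv G (Z x) * deriv Z x / G (Z x))) = Real.log (G (Z x)) + 1 := by
      have e1 : F' (Z x) * deriv Z x / F (Z x) = deriv Z x * G (Z x) := by
        simp only [hG]; ring
      have e2 : id x * (deriv G (Z x) * deriv Z x / G (Z x)) =
          Z x * (deriv G (Z x) * deriv Z x) := by
        simp only [id]
        nth_rewrite 1 [← hx1]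
        field_simp
      rw [e1, e2]
      linear_combination a6
    rw [e] at a5
    exact a5
  refine ⟨b, by positivity, ⟨{
    F := F
    z := Z
    d := fun x => F' (Z x)
    h := fun x => Real.log (F (Z x)) + x * Real.log (G (Z x))
    h' := fun x => Real.log (G (Z x)) + 1
    h'' := deriv fun x => Real.log (G (Z x))
    K := k + 2
    K_le := le_rfl
    b_le := (min_le_right _ _).trans (by push_cast; linarith [(Nat.cast_nonneg k : (0 : ℝ) ≤ k)])
    hasSum_F := fun z _ => hasSum_knomial_one_nat (k + 2) z
    z_mem := fun x hx => ⟨hZpos x hx, (hfact x (hsub hx)).2.2.2.1⟩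
    hasDerivAt_F := fun x _ => hFd (Z x)
    mean_eq := fun x hx => ?_
    h_eq := fun x hx => ?_
    h_zero := by simp [hZ0, hF0]
    continuousOn_h := fun x hx => (hder x hx).continuousAt.continuousWithinAt
    hasDerivAt_h := fun x hx => hder x (hsub hx)
    hasDerivAt_h' := fun x hx =>
      (hfact x (hsub hx)).1.2.2.differentiableAt.hasDerivAt.add_const 1
    strictConvexOn := hconv b hbε }⟩⟩
  · obtain ⟨-, -, hFpos, -, hx1, -⟩ := hfact x (hsub hx)
    nth_rewrite 3 [← hx1]
    simp only [hG]
    field_simp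
  · obtain ⟨-, hGpos, -, -, hx1, -⟩ := hfact x (hsub hx)
    have h := Real.log_mul (hZpos x hx).ne' hGpos.ne'
    rw [hx1] at h
    simp only [h]
    ring

theorem knomial_zero_right (κ : ℕ∞) (n : ℕ) : knomial κ n 0 = 1 := by
  classical
  induction n with
  | zero => simp [knomial_zero]
  | succ n ih => rw [knomial_add]; simp [ih, knomial_one]

theorem exists_sum_div_card_le {ι : Type*} [Fintype ι] [Nonempty ι] (f : ι → ℝ) :
    ∃ i, (∑ j, f j) / Fintype.card ι ≤ f i := by
  have hc : (0 : ℝ) < Fintype.card ι := by exact_mod_cast Fintype.card_pos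
  obtain ⟨i, -, hi⟩ := Finset.exists_le_of_sum_le (s := Finset.univ)
    (f := fun _ => (∑ j, f j) / Fintype.card ι) (g := f) Finset.univ_nonempty (by
      rw [Finset.sum_const, Finset.card_univ, nsmul_eq_mul, mul_div_cancel₀ _ hc.ne'])
  exact ⟨i, hi⟩

/-! ### Rates in terms of the entropy, and the two Jensen inequalities -/

namespace EntropyChart

variable {κ : ℕ∞} {b : ℝ} (E : EntropyChart κ b)

/-- The entropy at mean `x`. -/
noncomputable def entropy (x : ℝ) : ℝ := E.h x - x * Real.log x

include E in
theorem le_of_div_lt {n r : ℕ} (hn : 0 < n) (h : (r : ℝ) / n < b) : r < E.K * n := by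
  have hn' : (0 : ℝ) < n := by exact_mod_cast hn
  have h1 := h.trans_le E.b_le
  rw [div_lt_iff₀ hn'] at h1
  exact_mod_cast h1

/-- Cramér's theorem read in the chart. The case `r = 0` is separate because its tilting parameter
would be 0. -/
theorem tendsto_rate {n r : ℕ} (hn : 0 < n) (h : (r : ℝ) / n < b) :
    Tendsto (fun s : ℕ => 1 / (s : ℝ) * Real.log (knomial κ (s * n) (s * r))) atTop
      (𝓝 (n * E.entropy (r / n))) := by
  have hn' : (0 : ℝ) < n := by exact_mod_cast hn
  rcases Nat.eq_zero_or_pos r with rfl | hr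
  · simp [knomial_zero_right, entropy, E.h_zero]
  have hx : (r : ℝ) / n ∈ Set.Ioo 0 b := ⟨by positivity, h⟩
  have hm : E.z (r / n) * E.d (r / n) * n = r * E.F (E.z (r / n)) := by
    rw [E.mean_eq _ hx]
    field_simp
  have h1 := tendsto_log_knomial E.K_le E.hasSum_F (E.z_mem _ hx) (E.hasDerivAt_F _ hx) hr
    (E.le_of_div_lt hn h) hm
  have e : (n : ℝ) * Real.log (E.F (E.z (r / n))) - r * Real.log (E.z (r / n)) =
      n * E.entropy (r / n) := by
    rw [entropy, E.h_eq _ hx]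
    field_simp
    ring
  rwa [e] at h1

section Convexity

variable {I J : Type*} [Fintype I] [Fintype J] {u : I → ℝ} {y : J → ℝ} {Y : ℝ}

/-- The increment of the entropy under scaling by the weights `u`. -/
def spread (u : I → ℝ) (y : ℝ) : ℝ := ∑ i, E.h (u i * y) - Fintype.card I * E.h y

/-- Multiplied by `x ^ 2 / |I|`, the expression is the average of φ(u_i x) minus φ(x), where φ(x) =
x² h''(x). As the weights average 1, Jensen applies. -/
theorem spread_second_deriv_aux [Nonempty I] (hu : ∀ i, 0 ≤ u i) (hsum : ∑ i, u i = Fintype.card I)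
    (hY : ∀ i, u i * Y < b) {x : ℝ} (hx : x ∈ Set.Ioo 0 Y) :
    0 ≤ ∑ i, u i * (u i * E.h'' (u i * x)) - Fintype.card I * E.h'' x ∧
    ((∃ i i', u i ≠ u i') →
      0 < ∑ i, u i * (u i * E.h'' (u i * x)) - Fintype.card I * E.h'' x) := by
  have hc : (0 : ℝ) < Fintype.card I := by exact_mod_cast Fintype.card_pos
  have hx0 : 0 < x := hx.1
  have hmem : ∀ i ∈ Finset.univ, u i * x ∈ Set.Ico 0 b := fun i _ =>
    ⟨mul_nonneg (hu i) hx0.le, (mul_le_mul_of_nonneg_left hx.2.le (hu i)).trans_lt (hY i)⟩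
  have hw : ∑ _i : I, (Fintype.card I : ℝ)⁻¹ = 1 := by
    rw [Finset.sum_const, Finset.card_univ, nsmul_eq_mul, mul_inv_cancel₀ hc.ne']
  have hmean : ∑ i, (Fintype.card I : ℝ)⁻¹ • (u i * x) = x := by
    simp only [smul_eq_mul, ← Finset.mul_sum, ← Finset.sum_mul, hsum]
    field_simp
  have e : ∑ i, u i * (u i * E.h'' (u i * x)) - Fintype.card I * E.h'' x =
      Fintype.card I / x ^ 2 * (∑ i, (Fintype.card I : ℝ)⁻¹ • ((u i * x) ^ 2 * E.h'' (u i * x)) -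
        x ^ 2 * E.h'' x) := by
    simp only [smul_eq_mul, ← Finset.mul_sum]
    have : ∑ i, (u i * x) ^ 2 * E.h'' (u i * x) =
        x ^ 2 * ∑ i, u i * (u i * E.h'' (u i * x)) := by
      rw [Finset.mul_sum]
      exact Finset.sum_congr rfl fun i _ => by ring
    rw [this]
    generalize ∑ i, u i * (u i * E.h'' (u i * x)) = S
    field_simp
  rw [e]
  refine ⟨mul_nonneg (by positivity) (sub_nonneg.2 ?_), fun ⟨i, i', hne⟩ =>
    mul_pos (by positivity) (sub_pos.2 ?_)⟩
  · have h := E.strictConvexOn.convexOn.map_sum_le (t := Finset.univ)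
      (w := fun _ : I => (Fintype.card I : ℝ)⁻¹) (p := fun i => u i * x)
      (fun _ _ => by positivity) hw hmem
    rwa [hmean] at h
  · have h := E.strictConvexOn.map_sum_lt (t := Finset.univ)
      (w := fun _ : I => (Fintype.card I : ℝ)⁻¹) (p := fun i => u i * x)
      (fun _ _ => by positivity) hw hmem ⟨i, Finset.mem_univ _, i', Finset.mem_univ _,
        fun h => hne (mul_right_cancel₀ hx0.ne' h)⟩
    rwa [hmean] at h

theorem convexOn_spread [Nonempty I] (hY0 : 0 ≤ Y) (hu : ∀ i, 0 ≤ u i)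
    (hsum : ∑ i, u i = Fintype.card I) (hY : ∀ i, u i * Y < b) :
    ConvexOn ℝ (Set.Icc 0 Y) (E.spread u) ∧
      ((∃ i i', u i ≠ u i') → StrictConvexOn ℝ (Set.Icc 0 Y) (E.spread u)) := by
  have hc : (0 : ℝ) < Fintype.card I := by exact_mod_cast Fintype.card_pos
  -- Some weight is at least the average 1.
  have hYb : Y < b := by
    obtain ⟨i, hi⟩ := exists_sum_div_card_le u
    rw [hsum, div_self hc.ne'] at hi
    exact (le_mul_of_one_le_left hY0 hi).trans_lt (hY i)
  have hmem : ∀ i, ∀ x ∈ Set.Icc 0 Y, u i * x ∈ Set.Ico 0 b := fun i x hx =>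
    ⟨mul_nonneg (hu i) hx.1, (mul_le_mul_of_nonneg_left hx.2 (hu i)).trans_lt (hY i)⟩
  have hcont : ContinuousOn (E.spread u) (Set.Icc 0 Y) := by
    refine ContinuousOn.sub (continuousOn_finsetSum _ fun i _ => ?_) (continuousOn_const.mul ?_)
    · exact E.continuousOn_h.comp (by fun_prop) (hmem i)
    · exact E.continuousOn_h.mono fun x hx => ⟨hx.1, hx.2.trans_lt hYb⟩
  have hlin : ∀ i x, HasDerivAt (fun x : ℝ => u i * x) (u i) x := fun i x => by
    simpa using (hasDerivAt_id x).const_mul (u i)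
  have h1 : ∀ x ∈ Set.Ioo 0 Y, HasDerivAt (E.spread u)
      (∑ i, u i * E.h' (u i * x) - Fintype.card I * E.h' x) x := by
    intro x hx
    refine HasDerivAt.sub (HasDerivAt.fun_sum fun i _ => ?_)
      ((E.hasDerivAt_h x ⟨hx.1, hx.2.trans hYb⟩).const_mul _)
    -- A vanishing weight gives a constant term; the chart has no derivative at 0 to offer.
    rcases (hu i).eq_or_lt with h0 | h0
    · rw [← h0]; simpa using hasDerivAt_const x (E.h 0)
    · rw [mul_comm (u i)]
      exact (E.hasDerivAt_h _ ⟨mul_pos h0 hx.1, (hmem i x ⟨hx.1.le, hx.2.le⟩).2⟩).comp x (hlin i x)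
  have h2 : ∀ x ∈ Set.Ioo 0 Y, HasDerivAt
      (fun x => ∑ i, u i * E.h' (u i * x) - Fintype.card I * E.h' x)
      (∑ i, u i * (u i * E.h'' (u i * x)) - Fintype.card I * E.h'' x) x := by
    intro x hx
    refine HasDerivAt.sub (HasDerivAt.fun_sum fun i _ => HasDerivAt.const_mul _ ?_)
      ((E.hasDerivAt_h' x ⟨hx.1, hx.2.trans hYb⟩).const_mul _)
    rcases (hu i).eq_or_lt with h0 | h0
    · rw [← h0]; simpa using hasDerivAt_const x (E.h' 0)
    · rw [mul_comm (u i) (E.h'' _)]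
      exact (E.hasDerivAt_h' _ ⟨mul_pos h0 hx.1, (hmem i x ⟨hx.1.le, hx.2.le⟩).2⟩).comp x (hlin i x)
  rw [← interior_Icc] at h1 h2
  constructor
  · refine convexOn_of_hasDerivWithinAt2_nonneg (convex_Icc 0 Y) hcont
      (fun x hx => (h1 x hx).hasDerivWithinAt) (fun x hx => (h2 x hx).hasDerivWithinAt)
      fun x hx => ?_
    rw [interior_Icc] at hx
    exact (E.spread_second_deriv_aux hu hsum hY hx).1
  · intro hne
    refine strictConvexOn_of_hasDerivAt2 (convex_Icc 0 Y) hcont h1 h2 fun x hx => ?_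
    rw [interior_Icc] at hx
    exact (E.spread_second_deriv_aux hu hsum hY hx).2 hne

theorem card_mul_spread_le [Nonempty I] [Nonempty J] (hu : ∀ i, 0 ≤ u i)
    (hsum : ∑ i, u i = Fintype.card I) (hy : ∀ j, 0 ≤ y j) (huy : ∀ i j, u i * y j < b) :
    Fintype.card J * E.spread u ((∑ j, y j) / Fintype.card J) ≤ ∑ j, E.spread u (y j) ∧
      ((∃ i i', u i ≠ u i') → (∃ j j', y j ≠ y j') →
        Fintype.card J * E.spread u ((∑ j, y j) / Fintype.card J) < ∑ j, E.spread u (y j)) := by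
  have hc : (0 : ℝ) < Fintype.card J := by exact_mod_cast Fintype.card_pos
  obtain ⟨j₀, hj₀⟩ := Finite.exists_max y
  obtain ⟨h1, h2⟩ := E.convexOn_spread (hy j₀) hu hsum fun i => huy i j₀
  have hmem : ∀ j ∈ Finset.univ, y j ∈ Set.Icc 0 (y j₀) := fun j _ => ⟨hy j, hj₀ j⟩
  have hw : ∑ _j : J, (Fintype.card J : ℝ)⁻¹ = 1 := by
    rw [Finset.sum_const, Finset.card_univ, nsmul_eq_mul, mul_inv_cancel₀ hc.ne']
  have e : ∀ f : J → ℝ, ∑ j, (Fintype.card J : ℝ)⁻¹ • f j = (∑ j, f j) / Fintype.card J :=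
    fun f => by simp only [smul_eq_mul, ← Finset.mul_sum, div_eq_inv_mul]
  refine ⟨?_, fun hu' ⟨j, j', hne⟩ => ?_⟩
  · have h := h1.map_sum_le (t := Finset.univ) (w := fun _ : J => (Fintype.card J : ℝ)⁻¹)
      (fun _ _ => by positivity) hw hmem
    rw [e, e, le_div_iff₀ hc] at h
    linarith
  · have h := (h2 hu').map_sum_lt (t := Finset.univ) (w := fun _ : J => (Fintype.card J : ℝ)⁻¹)
      (fun _ _ => by positivity) hw hmem ⟨j, Finset.mem_univ _, j', Finset.mem_univ _, hne⟩
    rw [e, e, lt_div_iff₀ hc] at h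
    linarith

end Convexity

end EntropyChart

/-! ### Comparison of the two rates and the theorem -/

/-- The logarithm splits as log R_i + log C_j − log N, and summing against R_i C_j/N leaves only the
margins. Zero entries cause no trouble, as `0 * log 0 = 0`. -/
theorem sum_mul_log_independence {m n : ℕ} (hm : 0 < m) (hn : 0 < n) {R : Fin m → ℝ}
    {C : Fin n → ℝ} {N : ℝ} (hN : N ≠ 0) (hR : ∑ i, R i = N) (hC : ∑ j, C j = N) :
    ∑ i, ∑ j, R i * C j / N * Real.log (R i * C j / N) =
      ∑ i, n * (R i / n * Real.log (R i / n)) + ∑ j, m * (C j / m * Real.log (C j / m)) -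
        m * n * (N / (m * n) * Real.log (N / (m * n))) := by
  have hm' : (m : ℝ) ≠ 0 := by exact_mod_cast hm.ne'
  have hn' : (n : ℝ) ≠ 0 := by exact_mod_cast hn.ne'
  have h1 : ∀ (a : ℝ) (l : ℝ), l ≠ 0 → l * (a / l * Real.log (a / l)) =
      a * Real.log a - a * Real.log l := fun a l hl => by
    rcases eq_or_ne a 0 with rfl | ha
    · simp
    · rw [Real.log_div ha hl]; field_simp
  have h2 : ∀ i j, R i * C j / N * Real.log (R i * C j / N) =
      C j * (R i * Real.log (R i) / N) + R i * (C j * Real.log (C j) / N) -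
        R i * (C j * Real.log N / N) := fun i j => by
    rcases eq_or_ne (R i) 0 with h | h
    · simp [h]
    rcases eq_or_ne (C j) 0 with h' | h'
    · simp [h']
    rw [Real.log_div (mul_ne_zero h h') hN, Real.log_mul h h']
    field_simp
  simp only [h2, h1 _ _ hm', h1 _ _ hn', h1 _ _ (mul_ne_zero hm' hn'), Finset.sum_sub_distrib,
    Finset.sum_add_distrib, ← Finset.mul_sum, ← Finset.sum_mul, ← Finset.sum_div, hR, hC,
    Real.log_mul hm' hn']
  field_simp
  ring

theorem prod_clone {m s : ℕ} (V : Fin m → ℕ) (f : ℕ → ℝ) :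
    ∏ k, f (clone s V k) = (∏ i, f (s * V i)) ^ s := by
  rw [← finProdFinEquiv.prod_comp, Fintype.prod_prod_type]
  simp only [clone]
  have : ∀ (a : Fin s) (i : Fin m), (finProdFinEquiv (a, i)).modNat = i := fun a i => by
    have h : (finProdFinEquiv.symm (finProdFinEquiv (a, i))).2 = i := by simp
    exact h
  simp [this]

theorem sum_clone {m s : ℕ} (V : Fin m → ℕ) : ∑ k, clone s V k = s ^ 2 * ∑ i, V i := by
  rw [← finProdFinEquiv.sum_comp, Fintype.sum_prod_type]
  simp only [clone]
  have : ∀ (a : Fin s) (i : Fin m), (finProdFinEquiv (a, i)).modNat = i := fun a i => by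
    have h : (finProdFinEquiv.symm (finProdFinEquiv (a, i))).2 = i := by simp
    exact h
  simp [this, ← Finset.mul_sum, pow_two, mul_assoc]

theorem exists_limits_of_entropyChart {κ : ℕ∞} {b : ℝ} (E : EntropyChart κ b) {m n N : ℕ}
    {R : Fin m → ℕ} {C : Fin n → ℕ} (hN : 0 < N) (hR : ∑ i, R i = N) (hC : ∑ j, C j = N)
    (hT : 0 < tableCount κ R C) (hb : ∀ i j, (R i : ℝ) * C j < b * N) :
    ∃ LT LI : ℝ,
      Tendsto (fun s : ℕ => 1 / (s : ℝ) ^ 2 *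
        Real.log (tableCount κ (clone s R) (clone s C))) atTop (𝓝 LT) ∧
      Tendsto (fun s : ℕ => 1 / (s : ℝ) ^ 2 *
        Real.log (indepEstimate κ (clone s R) (clone s C))) atTop (𝓝 LI) ∧
      LI ≤ LT ∧ ((¬ ∀ i i', R i = R i') → (¬ ∀ j j', C j = C j') → LI < LT) := by
  have hm : 0 < m := by
    rcases Nat.eq_zero_or_pos m with rfl | h
    · simp at hR; omega
    · exact h
  have hn : 0 < n := by
    rcases Nat.eq_zero_or_pos n with rfl | h
    · simp at hC; omega
    · exact h
  have : Nonempty (Fin m) := ⟨⟨0, hm⟩⟩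
  have : Nonempty (Fin n) := ⟨⟨0, hn⟩⟩
  have hm' : (0 : ℝ) < m := by exact_mod_cast hm
  have hn' : (0 : ℝ) < n := by exact_mod_cast hn
  have hN' : (0 : ℝ) < N := by exact_mod_cast hN
  have hR' : ∑ i, (R i : ℝ) = N := by exact_mod_cast hR
  have hC' : ∑ j, (C j : ℝ) = N := by exact_mod_cast hC
  have hz : ∀ i j, (R i : ℝ) * C j / N < b := fun i j => by
    rw [div_lt_iff₀ hN']; exact hb i j
  -- A row and a column at least as large as the average: they bound all `R i / n`, `C j / m` and `N
  -- / (m * n)` by products `R i * C j / N`, hence by `b`.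
  obtain ⟨i₀, hi₀⟩ := exists_sum_div_card_le fun i => (R i : ℝ)
  obtain ⟨j₀, hj₀⟩ := exists_sum_div_card_le fun j => (C j : ℝ)
  rw [hR', Fintype.card_fin] at hi₀
  rw [hC', Fintype.card_fin] at hj₀
  have hrow : ∀ i, (R i : ℝ) / n < b := fun i => by
    refine lt_of_le_of_lt ?_ (hz i j₀)
    rw [le_div_iff₀ hN']
    calc (R i : ℝ) / n * N = R i * (N / n) := by ring
      _ ≤ R i * C j₀ := by gcongr
  have hcol : ∀ j, (C j : ℝ) / m < b := fun j => by
    refine lt_of_le_of_lt ?_ (hz i₀ j)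
    rw [le_div_iff₀ hN']
    calc (C j : ℝ) / m * N = N / m * C j := by ring
      _ ≤ R i₀ * C j := by gcongr
  have htot : (N : ℝ) / (m * n : ℕ) < b := by
    refine lt_of_le_of_lt ?_ (hrow i₀)
    push_cast
    rw [← div_div]
    gcongr
  obtain ⟨LT, hLT, hLT'⟩ := exists_tendsto_log_tableCount hT
  set LI : ℝ := ∑ i, n * E.entropy (R i / n) + ∑ j, m * E.entropy (C j / m) -
    m * n * E.entropy (N / (m * n)) with hLI
  have hlow : ∑ i, ∑ j, E.entropy (R i * C j / N) ≤ LT := by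
    refine sum_rate_le_of_tendsto hN hR hC hLT' (fun s i j => ?_) fun i j => ?_
    · refine knomial_pos E.K_le _ _ ?_
      have h : R i * C j < E.K * N := E.le_of_div_lt hN (by push_cast; exact hz i j)
      nlinarith
    · have h := E.tendsto_rate (n := N) (r := R i * C j) hN (by push_cast; exact hz i j)
      push_cast at h
      exact h
  have hkpos : ∀ {l r : ℕ}, 0 < l → (r : ℝ) / l < b → ∀ s, (0 : ℝ) < knomial κ (s * l) (s * r) := by
    intro l r hl h s
    have h1 := E.le_of_div_lt hl h
    have : 0 < knomial κ (s * l) (s * r) := knomial_pos E.K_le _ _ (by nlinarith)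
    exact_mod_cast this
  have hlogI : ∀ s : ℕ, Real.log (indepEstimate κ (clone s R) (clone s C)) =
      -Real.log (knomial κ (s ^ 2 * (m * n)) (s ^ 2 * N)) +
        s * ∑ i, Real.log (knomial κ (s * n) (s * R i)) +
        s * ∑ j, Real.log (knomial κ (s * m) (s * C j)) := by
    intro s
    have p0 := hkpos (Nat.mul_pos hm hn) htot (s ^ 2)
    have p1 : ∀ i, (knomial κ (s * n) (s * R i) : ℝ) ≠ 0 := fun i => (hkpos hn (hrow i) s).ne'
    have p2 : ∀ j, (knomial κ (s * m) (s * C j) : ℝ) ≠ 0 := fun j => (hkpos hm (hcol j) s).ne'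
    have q1 : ∏ i, (knomial κ (s * n) (s * R i) : ℝ) ≠ 0 := Finset.prod_ne_zero_iff.2 fun i _ => p1 i
    have q2 : ∏ j, (knomial κ (s * m) (s * C j) : ℝ) ≠ 0 := Finset.prod_ne_zero_iff.2 fun j _ => p2 j
    have e : s * m * (s * n) = s ^ 2 * (m * n) := by ring
    rw [indepEstimate, sum_clone, hR, e, prod_clone R fun r => (knomial κ (s * n) r : ℝ),
      prod_clone C fun r => (knomial κ (s * m) r : ℝ),
      Real.log_mul (mul_ne_zero (inv_ne_zero p0.ne') (pow_ne_zero _ q1)) (pow_ne_zero _ q2),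
      Real.log_mul (inv_ne_zero p0.ne') (pow_ne_zero _ q1), Real.log_inv, Real.log_pow,
      Real.log_pow, Real.log_prod fun i _ => p1 i, Real.log_prod fun j _ => p2 j]
  have hI : Tendsto (fun s : ℕ => 1 / (s : ℝ) ^ 2 *
      Real.log (indepEstimate κ (clone s R) (clone s C))) atTop (𝓝 LI) := by
    have t1 : Tendsto (fun s : ℕ => ∑ i, 1 / (s : ℝ) * Real.log (knomial κ (s * n) (s * R i)))
        atTop (𝓝 (∑ i, n * E.entropy (R i / n))) :=
      tendsto_finsetSum _ fun i _ => E.tendsto_rate hn (hrow i)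
    have t2 : Tendsto (fun s : ℕ => ∑ j, 1 / (s : ℝ) * Real.log (knomial κ (s * m) (s * C j)))
        atTop (𝓝 (∑ j, m * E.entropy (C j / m))) :=
      tendsto_finsetSum _ fun j _ => E.tendsto_rate hm (hcol j)
    have t3 := (E.tendsto_rate (Nat.mul_pos hm hn) htot).comp
      (tendsto_pow_atTop (α := ℕ) two_ne_zero)
    push_cast at t3
    refine ((t1.add t2).sub t3).congr fun s => ?_
    rw [hlogI]
    simp only [Function.comp, ← Finset.mul_sum]
    rcases Nat.eq_zero_or_pos s with rfl | hs
    · simp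
    have hs' : (s : ℝ) ≠ 0 := by exact_mod_cast hs.ne'
    push_cast
    field_simp
    ring
  have hu : ∀ i, 0 ≤ (R i : ℝ) * m / N := fun i => by positivity
  have hy : ∀ j, 0 ≤ (C j : ℝ) / m := fun j => by positivity
  have huy : ∀ i j, (R i : ℝ) * m / N * (C j / m) = R i * C j / N := fun i j => by field_simp
  have hmean : (∑ j, (C j : ℝ) / m) / Fintype.card (Fin n) = N / (m * n) := by
    rw [← Finset.sum_div, hC', Fintype.card_fin, div_div]
  have hua : ∀ i, (R i : ℝ) * m / N * (N / (m * n)) = R i / n := fun i => by field_simp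
  obtain ⟨hle, hlt⟩ := E.card_mul_spread_le (u := fun i => (R i : ℝ) * m / N)
    (y := fun j => (C j : ℝ) / m) hu (by
      rw [← Finset.sum_div, ← Finset.sum_mul, hR', Fintype.card_fin]; field_simp) hy
      fun i j => by rw [huy]; exact hz i j
  -- The x log x parts cancel, and what is left is exactly the Jensen gap of `spread`.
  have hdiff : ∑ i, ∑ j, E.entropy (R i * C j / N) - LI =
      ∑ j, E.spread (fun i => (R i : ℝ) * m / N) ((C j : ℝ) / m) -
        Fintype.card (Fin n) * E.spread (fun i => (R i : ℝ) * m / N)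
          ((∑ j, (C j : ℝ) / m) / Fintype.card (Fin n)) := by
    have hlog := sum_mul_log_independence hm hn hN'.ne' hR' hC'
    have hswap := Finset.sum_comm (s := Finset.univ) (t := Finset.univ)
      (f := fun (i : Fin m) (j : Fin n) => E.h (R i * C j / N))
    rw [hmean, hLI]
    simp only [EntropyChart.spread, EntropyChart.entropy, huy, hua, Fintype.card_fin, mul_sub,
      Finset.sum_sub_distrib, hlog, hswap, ← Finset.mul_sum]
    ring
  refine ⟨LT, LI, hLT, hI, by linarith, fun h1 h2 => ?_⟩
  push Not at h1 h2
  obtain ⟨i, i', hi⟩ := h1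
  obtain ⟨j, j', hj⟩ := h2
  have h := hlt ⟨i, i', fun h => hi ?_⟩ ⟨j, j', fun h => hj ?_⟩
  · linarith
  · have h3 : (R i : ℝ) = R i' := by
      field_simp at h
      exact h
    exact_mod_cast h3
  · have h3 : (C j : ℝ) = C j' := by
      field_simp at h
      exact h
    exact_mod_cast h3

theorem theorem4 (κ : ℕ∞) (hκ : 2 ≤ κ) :
    ∃ δ : ℝ, 0 < δ ∧ δ < 1 ∧
      ∀ (m n N : ℕ) (R : Fin m → ℕ) (C : Fin n → ℕ),
        ∑ i, R i = N → ∑ j, C j = N → 0 < tableCount κ R C →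
        ((Finset.univ.sup R : ℕ) : ℝ≥0∞) * ((Finset.univ.sup C : ℕ) : ℝ≥0∞) <
          ENNReal.ofReal δ * (κ : ℝ≥0∞) * (N : ℝ≥0∞) →
        ∃ LT LI : ℝ,
          Tendsto (fun s : ℕ => 1 / (s : ℝ) ^ 2 *
            Real.log (tableCount κ (clone s R) (clone s C))) atTop (𝓝 LT) ∧
          Tendsto (fun s : ℕ => 1 / (s : ℝ) ^ 2 *
            Real.log (indepEstimate κ (clone s R) (clone s C))) atTop (𝓝 LI) ∧
          LI ≤ LT ∧
          ((¬ ∀ i i', R i = R i') → (¬ ∀ j j', C j = C j') → LI < LT) := by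
  have hNpos : ∀ {a δ' : ℝ≥0∞} {N : ℕ}, a < δ' * N → 0 < N := fun {a δ' N} h => by
    rcases Nat.eq_zero_or_pos N with rfl | h0
    · simp at h
    · exact h0
  rcases eq_or_ne κ ⊤ with rfl | hκ'
  -- Any `δ` works for `κ = ⊤`: charts exist on all intervals, and `N + 1` is long enough because `R
  -- i * C j ≤ N * N`.
  · refine ⟨1 / 2, by norm_num, by norm_num, fun m n N R C hR hC hT h => ?_⟩
    obtain ⟨E⟩ := nonempty_entropyChart_top (N + 1)
    have hN := hNpos h
    refine exists_limits_of_entropyChart E hN hR hC hT fun i j => ?_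
    have hN' : (0 : ℝ) < N := by exact_mod_cast hN
    have h1 : (R i : ℝ) ≤ N := by
      exact_mod_cast hR ▸ Finset.single_le_sum (fun _ _ => Nat.zero_le _) (Finset.mem_univ i)
    have h2 : (C j : ℝ) ≤ N := by
      exact_mod_cast hC ▸ Finset.single_le_sum (fun _ _ => Nat.zero_le _) (Finset.mem_univ j)
    have h3 : (R i : ℝ) * C j ≤ N * N := by gcongr
    linarith
  · obtain ⟨K, rfl⟩ := ENat.ne_top_iff_exists.1 hκ'
    have hK : 2 ≤ K := by exact_mod_cast hκ
    have hK' : (0 : ℝ) < K := by exact_mod_cast (by omega : 0 < K)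
    obtain ⟨b, hb, ⟨E⟩⟩ := exists_entropyChart_nat hK
    -- The term `b / K` turns the hypothesis into `R i * C j < b * N`; the term `1 / 2` only ensures
    -- `δ < 1`.
    refine ⟨min (b / K) (1 / 2), by positivity, (min_le_right _ _).trans_lt (by norm_num),
      fun m n N R C hR hC hT h => ?_⟩
    refine exists_limits_of_entropyChart E (hNpos h) hR hC hT fun i j => ?_
    have h1 : ((R i * C j : ℕ) : ℝ≥0∞) < ENNReal.ofReal (b * N) := by
      calc ((R i * C j : ℕ) : ℝ≥0∞) ≤ ((Finset.univ.sup R * Finset.univ.sup C : ℕ) : ℝ≥0∞) := by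
            exact_mod_cast Nat.mul_le_mul (Finset.le_sup (f := R) (Finset.mem_univ i))
              (Finset.le_sup (f := C) (Finset.mem_univ j))
        _ < ENNReal.ofReal (min (b / K) (1 / 2)) * ((K : ℕ∞) : ℝ≥0∞) * (N : ℝ≥0∞) := by
            push_cast; exact h
        _ = ENNReal.ofReal (min (b / K) (1 / 2) * K * N) := by
            rw [ENNReal.ofReal_mul (by positivity), ENNReal.ofReal_mul (by positivity)]
            simp
        _ ≤ ENNReal.ofReal (b * N) := by
            refine ENNReal.ofReal_le_ofReal ?_
            gcongr
            calc min (b / K) (1 / 2) * (K : ℝ) ≤ b / K * K := by gcongr; exact min_le_left _ _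
              _ = b := by field_simp
    rw [← ENNReal.ofReal_natCast, ENNReal.ofReal_lt_ofReal_iff_of_nonneg (by positivity)] at h1
    exact_mod_cast h1
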